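/- Let $\mathbb T$ be a real Hilbert space with a bounded operator $\Omega$ such that $\Omega^*=-\Omega$, $\Omega^2=-I$, and put $\omega(x,y)=\langle x,\Omega y\rangle$. A subspace is Lagrangian if it is a maximal $\omega$-isotropic subspace, and $\operatorname{Sp}(\mathbb T,\omega)$ is the group of bounded automorphisms $g$ with $g^*\Omega g=\Omega$. For complementary closed subspaces $\mathbb A,\mathbb B$ let $[\mathbb{AB}]$ be the operator equal to $+1$ on $\mathbb A$ and $-1$ on $\mathbb B$. Let $\mathbb U\subset\mathbb R$ be an open interval. A curve $\mathbb H$ of Lagrangian subspaces on $\mathbb U$ is *regular* if $\mathbb H(s),\mathbb H(t)$ are complementary for $s\ne t$, if $u\mapsto[\mathbb H(u)\mathbb H(u)^\perp]$ is $C^\infty$ in operator norm, and if for every $u$ there is a bounded operator $\mathbb H_\prime(u)$ (the tangent covector) with $[\mathbb H(u+h)\mathbb H(u)]=2h^{-1}\mathbb H_\prime(u)+o(h^{-1})$ in operator norm as $h\to0$. It is *positive* if moreover $\omega(\mathbb H_\prime(u)x,x)\ge 0$ for all $u\in\mathbb U$, $x\in\mathbb T$. A *positive hyperbolic structure* is a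 pair $(J,K)$ of bounded operators on $\mathbb T$ with $J^*\Omega J=\Omega$, $K^*\Omega K=-\Omega$, $J^2=-I$, $K^2=I$, $JK+KJ=0$, and $\omega(Jx,x)>0$ for $x\neq0$. Let $\mathbb K_\pm=\ker(I\mp K)$, and give $\mathbb K_+$ the inner product $\omega(Jx,y)$; adjoints ${}^*$ of operators on $\mathbb K_+$ and the orthogonal group $O(\mathbb K_+)$ (isometries of $\mathbb K_+$ onto itself) refer to it. Write operators on $\mathbb T$ as $2\times2$ block matrices of operators on $\mathbb K_+$ by means of the isomorphism $\mathbb K_+\oplus\mathbb K_+\to\mathbb T$, $(k,l)\mapsto k+Jl$. **Theorem.** Let $\mathbb H$ be a positive regular curve of Lagrangian subspaces on $\mathbb U$ and $(J,K)$ a positive hyperbolic structure such that every $\mathbb H(u)$, $u\in\mathbb U$, is complementary to $\mathbb K_+$ and to $\mathbb K_-$. Then $\mathbb H(u)=\{H(u)k+Jk : k\in\mathbb K_+\}$ for a smooth curve $H$ of self-adjoint operators on $\mathbb K_+$ whose derivative $\dot H(u)$ is invertible and positive definite for every $u\in\mathbb U$. There is a curve $X$ of invertible operators on $\mathbb K_+$,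 defined on all of $\mathbb U$, with $$\dot X=-\tfrac12\dot H^{-1}\ddot H X,\qquad XX^*=\dot H^{-1}.$$ For every such $X$, put $Y=HX$ and $$M=\begin{bmatrix}\dot Y&Y\\ \dot X&X\end{bmatrix}.$$ Then: 1. $M$ is a smooth curve in $\operatorname{Sp}(\mathbb T,\omega)$, $\mathbb K_-$ is Lagrangian, and $M(u)^{-1}\mathbb H(u)=\mathbb K_-$ for all $u\in\mathbb U$ (so $M$ is a lift of $\mathbb H$). 2. The Maurer–Cartan form pulled back along $M$ is $\Theta\,du$ with $$\Theta=M^{-1}\dot M=\begin{bmatrix}0&I\\-\tfrac12\mathcal S&0\end{bmatrix},\qquad \mathcal S=\tfrac12X^*\bigl(2\dddot H-3\ddot H\dot H^{-1}\ddot H\bigr)X,$$ and $\mathcal S(u)$ (the Lagrange–Schwarzian) is self-adjoint. 3. The freedom in the construction is exactly $X\mapsto XR$, $M\mapsto M\begin{bmatrix}R&0\\0&R\end{bmatrix}$ with a constant $R\in O(\mathbb K_+)$. Moreover every smooth curve $N$ in $\operatorname{Sp}(\mathbb T,\omega)$ with $N(u)^{-1}\mathbb H(u)=\mathbb K_-$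 for all $u\in\mathbb U$, whose Maurer–Cartan form $N^{-1}\dot N$ has the shape $\begin{bmatrix}0&I\\ C(u)&0\end{bmatrix}$, equals $M\begin{bmatrix}R&0\\0&R\end{bmatrix}$ for some constant $R\in O(\mathbb K_+)$. -/

import Mathlib

open scoped ContDiff Topology

noncomputable section

namespace LagrangeLift

variable {T : Type*} [NormedAddCommGroup T] [InnerProductSpace ℝ T] [CompleteSpace T]

/-! ### Reflections and curves of subspaces -/

open Classical in
/-- The reflection `[A B]` of a pair of complementary subspaces: the bounded operator which is
`+1` on `A` and `-1` on `B` (and `0` if `A` and `B` are not complementary). -/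
def reflection (A B : Submodule ℝ T) : T →L[ℝ] T :=
  if h : A.IsTopCompl B then A.projectionL B h - B.projectionL A h.symm else 0

/-- `L` is the tangent covector at `u` of the curve `H` of subspaces:
`[H(u+h) H(u)] = 2 h⁻¹ L + o(h⁻¹)` in operator norm as `h → 0`. -/
def HasTangentCovector (H : ℝ → Submodule ℝ T) (u : ℝ) (L : T →L[ℝ] T) : Prop :=
  (fun h : ℝ => reflection (H (u + h)) (H u) - (2 * h⁻¹) • L) =o[𝓝[≠] 0] fun h : ℝ => h⁻¹

/-- A regular curve of closed subspaces on `U`: nondegenerate, codifferentiable and smooth, where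
smoothness is that of the reflections `[H(u) H(u)ᗮ]` in operator norm. -/
structure IsRegularCurve (U : Set ℝ) (H : ℝ → Submodule ℝ T) : Prop where
  isClosed : ∀ u ∈ U, IsClosed (H u : Set T)
  nondegenerate : ∀ s ∈ U, ∀ t ∈ U, s ≠ t → (H s).IsTopCompl (H t)
  codifferentiable : ∀ u ∈ U, ∃ L : T →L[ℝ] T, HasTangentCovector H u L
  smooth : ContDiffOn ℝ ∞ (fun u => reflection (H u) (H u)ᗮ) U

/-! ### Hilbert symplectic spaces -/

variable (T) in
/-- A Hermitian symplectic structure on a real Hilbert space. -/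
structure SymplecticStructure where
  /-- the operator `Ω` with `Ω* = -Ω` and `Ω² = -1` -/
  Om : T →L[ℝ] T
  adjoint_eq : ContinuousLinearMap.adjoint Om = -Om
  sq_eq : Om ∘L Om = -ContinuousLinearMap.id ℝ T

namespace SymplecticStructure

variable (S : SymplecticStructure T)

/-- The symplectic form `ω(x, y) = ⟨x, Ω y⟩`. -/
def form (x y : T) : ℝ := inner ℝ x (S.Om y)

/-- Isotropic subspaces. -/
def IsIsotropic (X : Submodule ℝ T) : Prop := ∀ x ∈ X, ∀ y ∈ X, S.form x y = 0

/-- Lagrangian subspaces: the maximal isotropic ones. -/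
def IsLagrangian (X : Submodule ℝ T) : Prop := Maximal S.IsIsotropic X

/-- Membership in the symplectic group. -/
def IsCanonical (g : T →L[ℝ] T) : Prop :=
  Function.Bijective g ∧ ContinuousLinearMap.adjoint g ∘L S.Om ∘L g = S.Om

/-- A regular curve in the Lagrangian Grassmannian is positive if the quadratic form
`x ↦ ω(L x, x)` of each of its tangent covectors `L` is positive semidefinite. -/
def IsPositiveRegularCurve (U : Set ℝ) (H : ℝ → Submodule ℝ T) : Prop :=
  IsRegularCurve U H ∧ (∀ u ∈ U, S.IsLagrangian (H u)) ∧
    ∀ u ∈ U, ∃ L : T →L[ℝ] T, HasTangentCovector H u L ∧ ∀ x, 0 ≤ S.form (L x) x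

/-- `M` is a lift of the curve `H` to the symplectic group, with
`M(u)⁻¹ H(u)` equal to the fixed Lagrangian subspace `B` for all `u`. -/
structure IsLift (U : Set ℝ) (H : ℝ → Submodule ℝ T) (B : Submodule ℝ T)
    (M : ℝ → T →L[ℝ] T) : Prop where
  smooth : ContDiffOn ℝ ∞ M U
  canonical : ∀ u ∈ U, S.IsCanonical (M u)
  lagrangian : S.IsLagrangian B
  comap_eq : ∀ u ∈ U, (H u).comap (M u : T →ₗ[ℝ] T) = B

end SymplecticStructure

/-- The pullback `M⁻¹ Ṁ` (coefficient of `du`) of the Maurer–Cartan form along the curve `M`. -/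
def maurerCartan (M : ℝ → T →L[ℝ] T) (u : ℝ) : T →L[ℝ] T := Ring.inverse (M u) * deriv M u

/-! ### Positive hyperbolic structures -/

/-- A positive hyperbolic structure `(J, K)`: `J` is symplectic, `K` is antisymplectic, `J² = -1`,
`K² = 1`, `J K + K J = 0`, and `ω(J x, y)` is positive definite. -/
structure HyperbolicStructure (S : SymplecticStructure T) where
  /-- the complex structure -/
  J : T →L[ℝ] T
  /-- the reflection -/
  K : T →L[ℝ] T
  canonical : ContinuousLinearMap.adjoint J ∘L S.Om ∘L J = S.Om
  anticanonical : ContinuousLinearMap.adjoint K ∘L S.Om ∘L K = -S.Om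
  J_sq : ∀ x, J (J x) = -x
  K_sq : ∀ x, K (K x) = x
  anticomm : ∀ x, J (K x) + K (J x) = 0
  positive : ∀ x, x ≠ 0 → 0 < S.form (J x) x

namespace HyperbolicStructure

variable {S : SymplecticStructure T} (P : HyperbolicStructure S)

/-- The subspace `K₊ = ker (1 - K)`. -/
def plus : Submodule ℝ T :=
  LinearMap.ker ((ContinuousLinearMap.id ℝ T - P.K : T →L[ℝ] T) : T →ₗ[ℝ] T)

/-- The subspace `K₋ = ker (1 + K)`. -/
def minus : Submodule ℝ T :=
  LinearMap.ker ((ContinuousLinearMap.id ℝ T + P.K : T →L[ℝ] T) : T →ₗ[ℝ] T)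

theorem mem_plus {x : T} : x ∈ P.plus ↔ P.K x = x := by
  have h : x ∈ P.plus ↔ x - P.K x = 0 := Iff.rfl
  rw [h, sub_eq_zero, eq_comm]

theorem mem_minus {x : T} : x ∈ P.minus ↔ P.K x = -x := by
  have h : x ∈ P.minus ↔ x + P.K x = 0 := Iff.rfl
  rw [h, add_comm, add_eq_zero_iff_eq_neg]

theorem K_J (x : T) : P.K (P.J x) = -P.J (P.K x) :=
  (neg_eq_of_add_eq_zero_right (P.anticomm x)).symm

/-- The positive definite inner product `ω(J x, y)`. -/
def g (x y : T) : ℝ := S.form (P.J x) y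

/-- The component of `x` in `K₊`. -/
def fst : T →L[ℝ] P.plus :=
  ((1 / 2 : ℝ) • (ContinuousLinearMap.id ℝ T + P.K)).codRestrict P.plus (by
    intro x
    rw [mem_plus]
    simp [P.K_sq, add_comm])

/-- The component of `x` in `K₋`, transported to `K₊` by `J⁻¹ = -J`. -/
def snd : T →L[ℝ] P.plus :=
  (-(P.J ∘L ((1 / 2 : ℝ) • (ContinuousLinearMap.id ℝ T - P.K)))).codRestrict P.plus (by
    intro x
    rw [mem_plus]
    simp [P.K_J, P.K_sq, sub_eq_neg_add, add_comm])

theorem coe_fst (x : T) : (P.fst x : T) = (1 / 2 : ℝ) • (x + P.K x) := rfl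

theorem coe_snd (x : T) : (P.snd x : T) = -P.J ((1 / 2 : ℝ) • (x - P.K x)) := rfl

/-- The identification `T ≃ K₊ ⊕ K₊` given by the hyperbolic structure: it is the identity on `K₊`
and `J⁻¹` on `K₋`, so its inverse is `(k, l) ↦ k + J l`. -/
def split : T ≃L[ℝ] P.plus × P.plus :=
  ContinuousLinearEquiv.equivOfInverse (P.fst.prod P.snd)
    ((P.plus.subtypeL).coprod (P.J ∘L P.plus.subtypeL))
    (by
      intro x
      simp only [ContinuousLinearMap.prod_apply, ContinuousLinearMap.coprod_apply,
        Submodule.subtypeL_apply, ContinuousLinearMap.comp_apply, coe_fst, coe_snd, map_neg,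
        P.J_sq]
      module)
    (by
      rintro ⟨k, l⟩
      have hk := P.mem_plus.1 k.2
      have hl := P.mem_plus.1 l.2
      ext
      · simp [coe_fst, P.K_J, hk, hl]
        module
      · simp [coe_snd, P.K_J, hk, hl, P.J_sq]
        module)

theorem split_symm_apply (k l : P.plus) : P.split.symm (k, l) = (k : T) + P.J l := rfl

/-- The operator on `T` with the block matrix `[[A, B], [C, D]]` in the splitting
`T = K₊ ⊕ K₋ ≃ K₊ ⊕ K₊`. -/
def block (A B C D : P.plus →L[ℝ] P.plus) : T →L[ℝ] T :=
  (P.split.symm : P.plus × P.plus →L[ℝ] T) ∘L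
    ((A.coprod B).prod (C.coprod D)) ∘L (P.split : T →L[ℝ] P.plus × P.plus)

theorem g_eq (x y : T) : P.g x y = inner ℝ x (-(S.Om (P.J y))) := by
  have h := congrArg (fun F : T →L[ℝ] T => F (P.J y)) P.canonical
  simp only [ContinuousLinearMap.comp_apply, P.J_sq, map_neg] at h
  rw [← h, neg_neg, ContinuousLinearMap.adjoint_inner_right]
  rfl

theorem g_comm (x y : T) : P.g x y = P.g y x := by
  rw [g_eq, g, SymplecticStructure.form, ← ContinuousLinearMap.adjoint_inner_left, S.adjoint_eq,
    neg_apply, real_inner_comm]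

theorem g_self_pos {x : T} (hx : x ≠ 0) : 0 < P.g x x := P.positive x hx

theorem g_K_K (x y : T) : P.g (P.K x) (P.K y) = P.g x y := by
  have h := congrArg (fun F : T →L[ℝ] T => inner ℝ (P.J x) (F y)) P.anticanonical
  simp only [ContinuousLinearMap.comp_apply, ContinuousLinearMap.adjoint_inner_right, P.K_J,
    inner_neg_left, neg_apply, inner_neg_right, neg_inj] at h
  exact h

/-- Every bounded operator on `K₊` has an adjoint for the inner product `ω(J x, y)`. -/
theorem exists_adj (X : P.plus →L[ℝ] P.plus) :
    ∃ Y : P.plus →L[ℝ] P.plus, ∀ k l : P.plus, P.g (X k) l = P.g k (Y l) := by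
  let X' : T →L[ℝ] T := P.plus.subtypeL ∘L X ∘L P.fst
  let G : T →L[ℝ] T := -(S.Om ∘L P.J)
  let Z : T →L[ℝ] T := -(P.J ∘L S.Om)
  have hO : ∀ x, S.Om (S.Om x) = -x := fun x =>
    congrArg (fun F : T →L[ℝ] T => F x) S.sq_eq
  have hGZ : ∀ x, G (Z x) = x := by
    intro x
    simp [G, Z, P.J_sq, hO]
  have hg : ∀ x y, P.g x y = inner ℝ x (G y) := fun x y => P.g_eq x y
  have hfst : ∀ k : P.plus, P.fst (k : T) = k := by
    intro k
    have hk := P.mem_plus.1 k.2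
    ext
    rw [coe_fst, hk]
    module
  have hproj : ∀ (k : P.plus) (y : T), P.g k (P.fst y : T) = P.g k y := by
    intro k y
    have h1 := P.g_K_K k y
    rw [P.mem_plus.1 k.2] at h1
    rw [coe_fst, hg, map_smul, map_add, inner_smul_right, inner_add_right, ← hg, ← hg, h1]
    ring
  refine ⟨P.fst ∘L Z ∘L ContinuousLinearMap.adjoint X' ∘L G ∘L P.plus.subtypeL, ?_⟩
  intro k l
  simp only [ContinuousLinearMap.comp_apply, Submodule.subtypeL_apply]
  rw [hproj, hg, hg, hGZ, ContinuousLinearMap.adjoint_inner_right]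
  simp [X', hfst]

/-- The adjoint `X*` of an operator on `K₊` for the inner product `ω(J x, y)`. -/
def adj (X : P.plus →L[ℝ] P.plus) : P.plus →L[ℝ] P.plus := Classical.choose (P.exists_adj X)

theorem g_adj (X : P.plus →L[ℝ] P.plus) (k l : P.plus) : P.g (X k) l = P.g k (P.adj X l) :=
  Classical.choose_spec (P.exists_adj X) k l

/-- The adjoint is unique. -/
theorem eq_adj (X Y : P.plus →L[ℝ] P.plus)
    (h : ∀ k l : P.plus, P.g (X k) l = P.g k (Y l)) : Y = P.adj X := by
  ext l
  by_contra hne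
  have hne' : ((Y l : T) - (P.adj X l : T)) ≠ 0 := sub_ne_zero.2 hne
  have h1 := P.g_self_pos hne'
  have h2 : P.g ((Y l - P.adj X l : P.plus) : T) ((Y l : T) - (P.adj X l : T)) = 0 := by
    rw [g_eq, map_sub, map_sub, neg_sub', inner_sub_right, ← g_eq, ← g_eq, ← h, ← g_adj, sub_self]
  rw [Submodule.coe_sub] at h2
  linarith

/-- The orthogonal group `O(K₊)` of `K₊` with the inner product `ω(J x, y)`. -/
def IsOrthogonal (R : P.plus →L[ℝ] P.plus) : Prop :=
  Function.Surjective R ∧ ∀ k l : P.plus, P.g (R k) (R l) = P.g k l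

/-- The subspace `im [H; 1] = {H k + J k : k ∈ K₊}`. -/
def graph (H : P.plus →L[ℝ] P.plus) : Submodule ℝ T :=
  LinearMap.range (((P.plus.subtypeL ∘L H) + P.J ∘L P.plus.subtypeL : P.plus →L[ℝ] T) :
    P.plus →ₗ[ℝ] T)

/-- `X(u)` is invertible, `Ẋ = -½ Ḣ⁻¹ Ḧ X` and `X X* = Ḣ⁻¹` on `U`. -/
structure IsFrame (U : Set ℝ) (H X : ℝ → P.plus →L[ℝ] P.plus) : Prop where
  isUnit : ∀ u ∈ U, IsUnit (X u)
  hasDerivAt : ∀ u ∈ U, HasDerivAt X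
    (-(1 / 2 : ℝ) • (Ring.inverse (deriv H u) * iteratedDeriv 2 H u * X u)) u
  mul_adj : ∀ u ∈ U, X u * P.adj (X u) = Ring.inverse (deriv H u)

/-- The curve `M = [[Ẏ, Y], [Ẋ, X]]` with `Y = H X`. -/
def lift (H X : ℝ → P.plus →L[ℝ] P.plus) (u : ℝ) : T →L[ℝ] T :=
  P.block (deriv (fun t => H t * X t) u) (H u * X u) (deriv X u) (X u)

/-- The Lagrange–Schwarzian `½ X* (2 H''' - 3 H'' H'⁻¹ H'') X`. -/
def schwarzian (H X : ℝ → P.plus →L[ℝ] P.plus) (u : ℝ) : P.plus →L[ℝ] P.plus :=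
  (1 / 2 : ℝ) • (P.adj (X u) *
    ((2 : ℝ) • iteratedDeriv 3 H u -
      (3 : ℝ) • (iteratedDeriv 2 H u * Ring.inverse (deriv H u) * iteratedDeriv 2 H u)) * X u)

end HyperbolicStructure

end LagrangeLift

end

/-!
In the coordinates `K₊ ⊕ K₊`, the subspaces `HH u` are the graphs of self-adjoint operators `H u`.
The lower left block of the reflection `[graph A, graph B]` is `2 (A - B)⁻¹`, so the tangent
covector of the curve has `Ḣ⁻¹` as its lower left block: this gives both the invertibility and the
positivity of `Ḣ`. If `X` solves `Ẋ = -½ Ḣ⁻¹ Ḧ X`, then `X* Ḣ X` is constant, so that `X X* = Ḣ⁻¹`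
is a condition on the initial value alone and two such `X` differ by a constant orthogonal factor.

The lift is the shear `[[1, H], [0, 1]]`, which carries `K₋` to the graph of `H`, times the lower
triangular matrix `[[Ḣ X, 0], [Ẋ, X]]`. Any lift `N` is the shear times a lower triangular matrix,
and the second column of `N⁻¹ Ṅ` expresses the entries of this matrix through its lower right
entry `X`; the first column of `N⁻¹ Ṅ` is then the differential equation for `X`, and
`N ∈ Sp(T, ω)` the normalization `X X* = Ḣ⁻¹`.
-/

noncomputable section

namespace LagrangeLift

/-! ### Linear differential equations in Banach spaces -/

section LinearODE

variable {E : Type*} [NormedAddCommGroup E] [NormedSpace ℝ E] {U : Set ℝ}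

theorem exists_forall_eq_of_hasDerivAt_zero (hU : IsOpen U) (hU' : U.OrdConnected) {f : ℝ → E}
    (hf : ∀ t ∈ U, HasDerivAt f 0 t) : ∃ c, ∀ t ∈ U, f t = c :=
  hU.exists_is_const_of_deriv_eq_zero hU'.isPreconnected
    (fun t ht => (hf t ht).differentiableAt.differentiableWithinAt) fun t ht => (hf t ht).deriv

theorem hasDerivAt_deriv_of_contDiffOn (hU : IsOpen U) {f : ℝ → E} (hf : ContDiffOn ℝ ∞ f U)
    {t : ℝ} (ht : t ∈ U) : HasDerivAt f (deriv f t) t :=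
  ((hf.contDiffAt (hU.mem_nhds ht)).differentiableAt (by simp)).hasDerivAt

theorem contDiffOn_deriv (hU : IsOpen U) {f : ℝ → E} (hf : ContDiffOn ℝ ∞ f U) :
    ContDiffOn ℝ ∞ (deriv f) U :=
  ((contDiffOn_infty_iff_deriv_of_isOpen hU).1 hf).2

theorem continuousOn_of_hasDerivAt {f f' : ℝ → E} (hf : ∀ t ∈ U, HasDerivAt f (f' t) t) :
    ContinuousOn f U :=
  fun t ht => (hf t ht).continuousAt.continuousWithinAt

theorem contDiffOn_of_hasDerivAt_apply (hU : IsOpen U) {a : ℝ → E →L[ℝ] E} {x : ℝ → E}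
    (ha : ContDiffOn ℝ ∞ a U) (hx : ∀ t ∈ U, HasDerivAt x (a t (x t)) t) :
    ContDiffOn ℝ ∞ x U := by
  rw [contDiffOn_infty]
  intro n
  induction n with
  | zero => exact contDiffOn_zero.2 (continuousOn_of_hasDerivAt hx)
  | succ n ih =>
    push_cast
    rw [contDiffOn_succ_iff_deriv_of_isOpen hU]
    exact ⟨fun t ht => (hx t ht).differentiableAt.differentiableWithinAt, by simp,
      ((contDiffOn_infty.1 ha n).clm_apply ih).congr fun t ht => (hx t ht).deriv⟩

theorem exists_Icc_subset_of_isOpen_of_ordConnected (hU : IsOpen U) (hU' : U.OrdConnected)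
    {s t : ℝ} (hs : s ∈ U) (ht : t ∈ U) :
    ∃ c d, s ∈ Set.Ioo c d ∧ t ∈ Set.Ioo c d ∧ Set.Icc c d ⊆ U := by
  obtain ⟨c, hc, hcU⟩ := (hU.eventually_mem (min_rec' (· ∈ U) hs ht)).exists_lt
  obtain ⟨d, hd, hdU⟩ := (hU.eventually_mem (max_rec' (· ∈ U) hs ht)).exists_gt
  rw [lt_min_iff] at hc
  rw [max_lt_iff] at hd
  exact ⟨c, d, ⟨hc.1, hd.1⟩, ⟨hc.2, hd.2⟩, hU'.out hcU hdU⟩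

/-- The terms of the Dyson series, whose sum is the solution of `x' = a x` with `x t₀ = x₀`. -/
def dysonTerm (a : ℝ → E →L[ℝ] E) (t₀ : ℝ) (x₀ : E) : ℕ → ℝ → E
  | 0 => fun _ => x₀
  | n + 1 => fun t => ∫ s in t₀..t, a s (dysonTerm a t₀ x₀ n s)

variable {a : ℝ → E →L[ℝ] E} {t₀ : ℝ}

theorem tsum_dysonTerm_self (a : ℝ → E →L[ℝ] E) (t₀ : ℝ) (x₀ : E) :
    ∑' n, dysonTerm a t₀ x₀ n t₀ = x₀ := by
  rw [tsum_eq_single 0]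
  · rfl
  · rintro (_ | n) hn
    · exact absurd rfl hn
    · simp [dysonTerm]

theorem norm_dysonTerm_le (hU' : U.OrdConnected) (ht₀ : t₀ ∈ U) (x₀ : E) {C : ℝ}
    (hC : ∀ t ∈ U, ‖a t‖ ≤ C) (n : ℕ) :
    ∀ t ∈ U, ‖dysonTerm a t₀ x₀ n t‖ ≤ (C * |t - t₀|) ^ n / n.factorial * ‖x₀‖ := by
  have hC0 : 0 ≤ C := (norm_nonneg _).trans (hC t₀ ht₀)
  induction n with
  | zero => simp [dysonTerm]
  | succ n ih =>
    intro t ht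
    have hbound : ∀ s ∈ Set.uIoc t₀ t, ‖a s (dysonTerm a t₀ x₀ n s)‖ ≤
        C ^ (n + 1) / n.factorial * ‖x₀‖ * |s - t₀| ^ n := fun s hs => by
      have hsU : s ∈ U := hU'.uIcc_subset ht₀ ht (Set.uIoc_subset_uIcc hs)
      calc ‖a s (dysonTerm a t₀ x₀ n s)‖
          ≤ C * ((C * |s - t₀|) ^ n / n.factorial * ‖x₀‖) :=
            (a s).le_of_opNorm_le_of_le (hC s hsU) (ih s hsU)
        _ = C ^ (n + 1) / n.factorial * ‖x₀‖ * |s - t₀| ^ n := by ring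
    calc ‖dysonTerm a t₀ x₀ (n + 1) t‖
        ≤ |∫ s in t₀..t, C ^ (n + 1) / n.factorial * ‖x₀‖ * |s - t₀| ^ n| :=
          intervalIntegral.norm_integral_le_abs_of_norm_le
            ((MeasureTheory.ae_restrict_mem measurableSet_uIoc).mono hbound)
            (Continuous.intervalIntegrable (by fun_prop) _ _)
      _ = (C * |t - t₀|) ^ (n + 1) / (n + 1).factorial * ‖x₀‖ := by
          rw [intervalIntegral.integral_const_mul, abs_mul,
            intervalIntegral.abs_intervalIntegral_eq, integral_pow_abs_sub_uIoc,
            abs_of_nonneg (by positivity), abs_of_nonneg (by positivity), mul_pow,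
            Nat.factorial_succ]
          push_cast
          field_simp

variable [CompleteSpace E]

theorem hasDerivAt_integral_of_continuousOn (hU : IsOpen U) (hU' : U.OrdConnected) {f : ℝ → E}
    (hf : ContinuousOn f U) (ht₀ : t₀ ∈ U) {t : ℝ} (ht : t ∈ U) :
    HasDerivAt (fun t => ∫ s in t₀..t, f s) (f t) t :=
  intervalIntegral.integral_hasDerivAt_right
    ((hf.mono (hU'.uIcc_subset ht₀ ht)).intervalIntegrable)
    (hf.stronglyMeasurableAtFilter hU t ht) (hf.continuousAt (hU.mem_nhds ht))

theorem continuousOn_dysonTerm (hU : IsOpen U) (hU' : U.OrdConnected) (ha : ContinuousOn a U)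
    (ht₀ : t₀ ∈ U) (x₀ : E) (n : ℕ) : ContinuousOn (dysonTerm a t₀ x₀ n) U := by
  induction n with
  | zero => exact continuousOn_const
  | succ n ih =>
    exact continuousOn_of_hasDerivAt fun t ht =>
      hasDerivAt_integral_of_continuousOn hU hU' (ha.clm_apply ih) ht₀ ht

theorem hasDerivAt_tsum_dysonTerm {c d C : ℝ} (ha : ContinuousOn a (Set.Ioo c d))
    (hC : ∀ t ∈ Set.Ioo c d, ‖a t‖ ≤ C) (ht₀ : t₀ ∈ Set.Ioo c d) (x₀ : E) {t : ℝ}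
    (ht : t ∈ Set.Ioo c d) :
    HasDerivAt (fun s => ∑' n, dysonTerm a t₀ x₀ n s) (a t (∑' n, dysonTerm a t₀ x₀ n t)) t := by
  have hC0 : 0 ≤ C := (norm_nonneg _).trans (hC t ht)
  have hbound : ∀ n, ∀ s ∈ Set.Ioo c d,
      ‖dysonTerm a t₀ x₀ n s‖ ≤ (C * (d - c)) ^ n / n.factorial * ‖x₀‖ := fun n s hs => by
    refine (norm_dysonTerm_le Set.ordConnected_Ioo ht₀ x₀ hC n s hs).trans ?_
    gcongr
    rw [abs_le]
    constructor <;> linarith [hs.1, hs.2, ht₀.1, ht₀.2]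
  have hsum := (Real.summable_pow_div_factorial (C * (d - c))).mul_right ‖x₀‖
  have hsum' : ∀ s ∈ Set.Ioo c d, Summable fun n => dysonTerm a t₀ x₀ n s := fun s hs =>
    Summable.of_norm_bounded hsum fun n => hbound n s hs
  have htail : HasDerivAt (fun s => ∑' n, dysonTerm a t₀ x₀ (n + 1) s)
      (∑' n, a t (dysonTerm a t₀ x₀ n t)) t :=
    hasDerivAt_tsum_of_isPreconnected (hsum.mul_left C) isOpen_Ioo isPreconnected_Ioo
      (fun n s hs => hasDerivAt_integral_of_continuousOn isOpen_Ioo Set.ordConnected_Ioo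
        (ha.clm_apply (continuousOn_dysonTerm isOpen_Ioo Set.ordConnected_Ioo ha ht₀ x₀ n)) ht₀ hs)
      (fun n s hs => (a s).le_of_opNorm_le_of_le (hC s hs) (hbound n s hs))
      ht ((summable_nat_add_iff 1).2 (hsum' t ht)) ht
  rw [(a t).map_tsum (hsum' t ht)]
  refine (htail.const_add x₀).congr_of_eventuallyEq ?_
  filter_upwards [Ioo_mem_nhds ht.1 ht.2] with s hs
  rw [(hsum' s hs).tsum_eq_zero_add]
  rfl

theorem exists_hasDerivAt_apply (hU : IsOpen U) (hU' : U.OrdConnected) (ha : ContinuousOn a U)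
    (ht₀ : t₀ ∈ U) (x₀ : E) :
    ∃ x : ℝ → E, x t₀ = x₀ ∧ ∀ t ∈ U, HasDerivAt x (a t (x t)) t := by
  refine ⟨fun t => ∑' n, dysonTerm a t₀ x₀ n t, tsum_dysonTerm_self a t₀ x₀, fun t ht => ?_⟩
  obtain ⟨c, d, htcd, ht₀cd, hcdU⟩ := exists_Icc_subset_of_isOpen_of_ordConnected hU hU' ht ht₀
  obtain ⟨C, hC⟩ := isCompact_Icc.exists_bound_of_continuousOn (ha.mono hcdU)
  exact hasDerivAt_tsum_dysonTerm (ha.mono (Set.Ioo_subset_Icc_self.trans hcdU))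
    (fun s hs => hC s (Set.Ioo_subset_Icc_self hs)) ht₀cd x₀ htcd

end LinearODE

/-! ### Smooth curves in Banach algebras -/

section BanachAlgebra

theorem isUnit_of_mul_eq_one_of_isPreconnected {A α : Type*} [NormedRing A] [CompleteSpace A]
    [TopologicalSpace α] {s : Set α} (hs : IsPreconnected s) {f g : α → A} (hf : ContinuousOn f s)
    (hg : ContinuousOn g s) (hgf : ∀ t ∈ s, g t * f t = 1) {t₀ : α} (ht₀ : t₀ ∈ s)
    (h₀ : IsUnit (f t₀)) : ∀ t ∈ s, IsUnit (f t) := by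
  have := Subtype.preconnectedSpace hs
  rw [continuousOn_iff_continuous_domRestrict] at hf hg
  have hunits : {t : s | IsUnit (f t)} = {t : s | f t * g t = 1} := by
    ext t
    refine ⟨fun hu => hu.mul_right_cancel ?_, fun h => ⟨⟨f t, g t, h, hgf t t.2⟩, rfl⟩⟩
    rw [mul_assoc, hgf t t.2, mul_one, one_mul]
  have hopen : IsOpen {t : s | IsUnit (f t)} := Units.isOpen.preimage hf
  have hclosed : IsClosed {t : s | IsUnit (f t)} :=
    hunits ▸ isClosed_eq (hf.mul hg) continuous_const
  have huniv := IsClopen.eq_univ ⟨hclosed, hopen⟩ ⟨⟨t₀, ht₀⟩, h₀⟩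
  exact fun t ht => Set.eq_univ_iff_forall.1 huniv ⟨t, ht⟩

variable {A : Type*} [NormedRing A] [NormedAlgebra ℝ A] {U : Set ℝ}

theorem contDiffOn_of_hasDerivAt_mul (hU : IsOpen U) {a x : ℝ → A} (ha : ContDiffOn ℝ ∞ a U)
    (hx : ∀ t ∈ U, HasDerivAt x (a t * x t) t) : ContDiffOn ℝ ∞ x U :=
  contDiffOn_of_hasDerivAt_apply hU ((ContinuousLinearMap.mul ℝ A).contDiff.comp_contDiffOn ha) hx

theorem hasDerivAt_deriv_and_deriv_eq_of_eq_mul_right {X Y : ℝ → A} {R : A} (hU : IsOpen U)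
    (hXY : ∀ u ∈ U, Y u = X u * R) {u : ℝ} (hu : u ∈ U)
    (hX : HasDerivAt X (deriv X u) u) :
    HasDerivAt Y (deriv Y u) u ∧ deriv Y u = deriv X u * R := by
  have hY : HasDerivAt Y (deriv X u * R) u :=
    (hX.mul_const R).congr_of_eventuallyEq (Filter.eventually_of_mem (hU.mem_nhds hu) hXY)
  exact ⟨hY.differentiableAt.hasDerivAt, hY.deriv⟩

theorem mul_eq_one_of_hasDerivAt_of_tendsto {H D : ℝ → A} {p d : A} {u : ℝ} (hH : HasDerivAt H p u)
    (hD : Filter.Tendsto (fun h => h • D h) (𝓝[≠] 0) (𝓝 d))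
    (hone : ∀ᶠ h in 𝓝[≠] 0, (H (u + h) - H u) * D h = 1 ∧ D h * (H (u + h) - H u) = 1) :
    p * d = 1 ∧ d * p = 1 := by
  have hslope := hH.tendsto_slope_zero
  constructor
  · refine tendsto_nhds_unique ((hslope.mul hD).congr' ?_) tendsto_const_nhds
    filter_upwards [hone, self_mem_nhdsWithin] with h hh hh0
    rw [smul_mul_smul_comm, inv_mul_cancel₀ hh0, one_smul, hh.1]
  · refine tendsto_nhds_unique ((hD.mul hslope).congr' ?_) tendsto_const_nhds
    filter_upwards [hone, self_mem_nhdsWithin] with h hh hh0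
    rw [smul_mul_smul_comm, mul_inv_cancel₀ hh0, one_smul, hh.2]

variable [CompleteSpace A]

theorem exists_hasDerivAt_mul (hU : IsOpen U) (hU' : U.OrdConnected) {a : ℝ → A}
    (ha : ContinuousOn a U) {t₀ : ℝ} (ht₀ : t₀ ∈ U) (x₀ : A) :
    ∃ x : ℝ → A, x t₀ = x₀ ∧ ∀ t ∈ U, HasDerivAt x (a t * x t) t :=
  exists_hasDerivAt_apply hU hU' ((ContinuousLinearMap.mul ℝ A).continuous.comp_continuousOn ha)
    ht₀ x₀

theorem hasDerivAt_ringInverse {p : ℝ → A} {p' : A} {t : ℝ} (hpt : IsUnit (p t))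
    (hp : HasDerivAt p p' t) :
    HasDerivAt (fun s => Ring.inverse (p s))
      (-(Ring.inverse (p t) * p' * Ring.inverse (p t))) t := by
  obtain ⟨v, hv⟩ := hpt
  have hinv := hasFDerivAt_ringInverse (𝕜 := ℝ) v
  rw [hv] at hinv
  rw [← hv, Ring.inverse_unit]
  simpa using! hinv.comp_hasDerivAt t hp

theorem contDiffOn_ringInverse {n : WithTop ℕ∞} {p : ℝ → A} (hpu : ∀ t ∈ U, IsUnit (p t))
    (hp : ContDiffOn ℝ n p U) : ContDiffOn ℝ n (fun t => Ring.inverse (p t)) U := by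
  intro t ht
  obtain ⟨v, hv⟩ := hpu t ht
  have hinv := contDiffAt_ringInverse ℝ (n := n) v
  rw [hv] at hinv
  exact hinv.comp_contDiffWithinAt t (hp t ht)

end BanachAlgebra

/-! ### Curves of bounded operators -/

section BoundedOperators

theorem hasDerivAt_comp_comp {E F G K : Type*} [NormedAddCommGroup E] [NormedSpace ℝ E]
    [NormedAddCommGroup F] [NormedSpace ℝ F] [NormedAddCommGroup G] [NormedSpace ℝ G]
    [NormedAddCommGroup K] [NormedSpace ℝ K] {x : ℝ → F →L[ℝ] G} {x' : F →L[ℝ] G} {u : ℝ}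
    (hx : HasDerivAt x x' u) (f : G →L[ℝ] K) (i : E →L[ℝ] F) :
    HasDerivAt (fun t => f ∘L x t ∘L i) (f ∘L x' ∘L i) u := by
  simpa using (hasDerivAt_const u f).clm_comp (hx.clm_comp (hasDerivAt_const u i))

theorem contDiffOn_of_comp_eq_comp_comp {E F : Type*} [NormedAddCommGroup E] [NormedSpace ℝ E]
    [CompleteSpace E] [NormedAddCommGroup F] [NormedSpace ℝ F] {p q : F →L[ℝ] E} {U : Set ℝ}
    {H : ℝ → E →L[ℝ] E} {Q : ℝ → F →L[ℝ] F} (hU : IsOpen U) (hQ : ContDiffOn ℝ ∞ Q U)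
    (hpq : ∀ u ∈ U, p ∘L Q u = H u ∘L q ∘L Q u)
    (hq : ∀ u ∈ U, ∃ G : E →L[ℝ] F, q ∘L Q u ∘L G = 1) : ContDiffOn ℝ ∞ H U := by
  intro u hu
  obtain ⟨G, hG⟩ := hq u hu
  have smooth (r : F →L[ℝ] E) : ContDiffAt ℝ ∞ (fun t => r ∘L Q t ∘L G) u :=
    contDiffAt_const.clm_comp ((hQ.contDiffAt (hU.mem_nhds hu)).clm_comp contDiffAt_const)
  have hunit : IsUnit (q ∘L Q u ∘L G) := by simp [hG]
  have hring : ContDiffAt ℝ ∞ Ring.inverse (q ∘L Q u ∘L G) :=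
    contDiffAt_ringInverse ℝ hunit.unit
  have hinv : ContDiffAt ℝ ∞ (fun t => Ring.inverse (q ∘L Q t ∘L G)) u :=
    ContDiffAt.comp (f := fun t => q ∘L Q t ∘L G) u hring (smooth q)
  refine (((smooth p).clm_comp hinv).congr_of_eventuallyEq ?_).contDiffWithinAt
  filter_upwards [hU.mem_nhds hu,
    (smooth q).continuousAt.eventually (Units.isOpen.mem_nhds hunit)] with t ht htu
  have hfactor : p ∘L Q t ∘L G = H t * (q ∘L Q t ∘L G) := congrArg (· ∘L G) (hpq t ht)
  exact (hfactor ▸ Ring.mul_inverse_cancel_right _ _ htu).symm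

theorem tendsto_smul_of_isLittleO {B : Type*} [NormedAddCommGroup B] [NormedSpace ℝ B]
    {R : ℝ → B} {L : B}
    (hR : (fun h : ℝ => R h - (2 * h⁻¹) • L) =o[𝓝[≠] 0] fun h : ℝ => h⁻¹) :
    Filter.Tendsto (fun h => h • (1 / 2 : ℝ) • R h) (𝓝[≠] 0) (𝓝 L) := by
  have hdiff : Filter.Tendsto (fun h : ℝ => h • (R h - (2 * h⁻¹) • L)) (𝓝[≠] 0) (𝓝 0) := by
    rw [← Asymptotics.isLittleO_one_iff ℝ]
    refine ((Asymptotics.isBigO_refl (fun h : ℝ => h) _).smul_isLittleO hR).congr' .rfl ?_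
    filter_upwards [self_mem_nhdsWithin] with h hh
    exact mul_inv_cancel₀ hh
  have hlim := (hdiff.const_smul (1 / 2 : ℝ)).add_const L
  rw [smul_zero, zero_add] at hlim
  refine hlim.congr' ?_
  filter_upwards [self_mem_nhdsWithin] with h (hh : h ≠ 0)
  match_scalars <;> field_simp
  ring

end BoundedOperators

/-! ### Parallel frames and their Schwarzian in star Banach algebras -/

theorem mul_mul_eq_one_iff_mul_eq_ringInverse {M : Type*} [MonoidWithZero M] {x y p : M}
    (hx : IsUnit x) (hp : IsUnit p) : y * p * x = 1 ↔ x * y = Ring.inverse p := by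
  refine ⟨fun h => ?_, fun h => hx.mul_left_cancel ?_⟩
  · have hxy : x * y * p = 1 := hx.mul_right_cancel (by rw [mul_assoc x, mul_assoc, h]; simp)
    rw [← mul_one (x * y), ← Ring.mul_inverse_cancel p hp, ← mul_assoc, hxy, one_mul]
  · rw [← mul_assoc, ← mul_assoc, h, Ring.inverse_mul_cancel p hp, one_mul, mul_one]

section StarBanachAlgebra

variable {A : Type*} [NormedRing A] [NormedAlgebra ℝ A] [StarRing A] {U : Set ℝ} {p X Y : ℝ → A}

/-- A frame of the curve `p` of invertible self-adjoint elements: it is orthonormal for `p`, in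
the form `X X* = p⁻¹`, and parallel for the connection `d/du + ½ p⁻¹ p'`. For `p = Ḣ` these are the
frames `X` from which the lift of the curve `H` is built. -/
structure IsParallelFrame (U : Set ℝ) (p X : ℝ → A) : Prop where
  isUnit : ∀ u ∈ U, IsUnit (X u)
  hasDerivAt : ∀ u ∈ U, HasDerivAt X (-(1 / 2 : ℝ) • (Ring.inverse (p u) * deriv p u * X u)) u
  mul_star : ∀ u ∈ U, X u * star (X u) = Ring.inverse (p u)

/-- The Schwarzian `½ X* (2 p'' - 3 p' p⁻¹ p') X` of the parallel frame `X` of `p`; for `p = Ḣ` it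
is the Lagrange–Schwarzian of `H`. -/
def frameSchwarzian (p X : ℝ → A) (u : ℝ) : A :=
  (1 / 2 : ℝ) • (star (X u) *
    ((2 : ℝ) • deriv (deriv p) u - (3 : ℝ) • (deriv p u * Ring.inverse (p u) * deriv p u)) * X u)

namespace IsParallelFrame

theorem of_hasDerivAt_mul {c d : ℝ → A} (hp : ∀ u ∈ U, HasDerivAt p (deriv p u) u)
    (hpu : ∀ u ∈ U, IsUnit (p u)) (hd : ∀ u ∈ U, HasDerivAt d (c u) u)
    (hpd : ∀ u ∈ U, HasDerivAt (fun t => p t * d t) (-(p u * c u)) u)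
    (hdu : ∀ u ∈ U, IsUnit (d u)) (hone : ∀ u ∈ U, star (d u) * p u * d u = 1) :
    IsParallelFrame U p d where
  isUnit := hdu
  hasDerivAt u hu := by
    have hp'd : deriv p u * d u = -(2 : ℝ) • (p u * c u) := by
      rw [eq_sub_of_add_eq (((hp u hu).mul (hd u hu)).unique (hpd u hu))]
      module
    refine (hd u hu).congr_deriv ?_
    rw [mul_assoc, hp'd, mul_smul_comm, Ring.inverse_mul_cancel_left _ _ (hpu u hu), smul_smul]
    norm_num
  mul_star u hu := (mul_mul_eq_one_iff_mul_eq_ringInverse (hdu u hu) (hpu u hu)).1 (hone u hu)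

theorem star_mul_mul (hX : IsParallelFrame U p X) (hpu : ∀ u ∈ U, IsUnit (p u)) {u : ℝ}
    (hu : u ∈ U) : star (X u) * p u * X u = 1 :=
  (mul_mul_eq_one_iff_mul_eq_ringInverse (hX.isUnit u hu) (hpu u hu)).2 (hX.mul_star u hu)

theorem mul_deriv (hX : IsParallelFrame U p X) (hpu : ∀ u ∈ U, IsUnit (p u)) {u : ℝ}
    (hu : u ∈ U) : p u * deriv X u = -(1 / 2 : ℝ) • (deriv p u * X u) := by
  rw [(hX.hasDerivAt u hu).deriv, mul_smul_comm, mul_assoc,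
    Ring.mul_inverse_cancel_left _ _ (hpu u hu)]

theorem hasDerivAt_mul (hX : IsParallelFrame U p X) (hp : ∀ u ∈ U, HasDerivAt p (deriv p u) u)
    (hpu : ∀ u ∈ U, IsUnit (p u)) {u : ℝ} (hu : u ∈ U) :
    HasDerivAt (fun t => p t * X t) (-(p u * deriv X u)) u := by
  refine ((hp u hu).mul (hX.hasDerivAt u hu)).congr_deriv ?_
  rw [← (hX.hasDerivAt u hu).deriv, hX.mul_deriv hpu hu]
  module

theorem mul_right (hX : IsParallelFrame U p X) {R : A} (hR : R ∈ unitary A) :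
    IsParallelFrame U p fun u => X u * R where
  isUnit u hu := (hX.isUnit u hu).mul ⟨Unitary.toUnits ⟨R, hR⟩, rfl⟩
  hasDerivAt u hu := ((hX.hasDerivAt u hu).mul_const R).congr_deriv (by
    rw [smul_mul_assoc, mul_assoc _ _ R])
  mul_star u hu := by
    rw [star_mul, mul_assoc, ← mul_assoc R, Unitary.mul_star_self_of_mem hR, one_mul,
      hX.mul_star u hu]

section CompleteSpace

variable [CompleteSpace A]

theorem contDiffOn (hX : IsParallelFrame U p X) (hU : IsOpen U) (hp : ContDiffOn ℝ ∞ p U)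
    (hpu : ∀ u ∈ U, IsUnit (p u)) : ContDiffOn ℝ ∞ X U :=
  contDiffOn_of_hasDerivAt_mul hU
    (((contDiffOn_ringInverse hpu hp).mul (contDiffOn_deriv hU hp)).const_smul (-(1 / 2 : ℝ)))
    fun t ht => (hX.hasDerivAt t ht).congr_deriv (smul_mul_assoc _ _ _).symm

theorem hasDerivAt_deriv (hX : IsParallelFrame U p X) (hU : IsOpen U) (hp : ContDiffOn ℝ ∞ p U)
    (hpu : ∀ u ∈ U, IsUnit (p u)) {u : ℝ} (hu : u ∈ U) :
    HasDerivAt (deriv X) (X u * (-(1 / 2 : ℝ) • frameSchwarzian p X u)) u := by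
  have hderiv : deriv X =ᶠ[𝓝 u] fun t =>
      -(1 / 2 : ℝ) • (Ring.inverse (p t) * deriv p t * X t) := by
    filter_upwards [hU.mem_nhds hu] with t ht using (hX.hasDerivAt t ht).deriv
  have hp' := hasDerivAt_deriv_of_contDiffOn hU hp hu
  have hp'' := hasDerivAt_deriv_of_contDiffOn hU (contDiffOn_deriv hU hp) hu
  refine (((((hasDerivAt_ringInverse (hpu u hu) hp').mul hp'').mul
    (hX.hasDerivAt u hu)).const_smul (-(1 / 2 : ℝ))).congr_of_eventuallyEq hderiv).congr_deriv ?_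
  rw [frameSchwarzian, mul_smul_comm (-(1 / 2 : ℝ)) (X u), mul_smul_comm (1 / 2 : ℝ) (X u),
    ← mul_assoc (X u), ← mul_assoc (X u), hX.mul_star u hu]
  simp only [Pi.mul_apply, mul_assoc, mul_sub, sub_mul, add_mul, mul_smul_comm, smul_mul_assoc,
    neg_mul]
  module

end CompleteSpace

end IsParallelFrame

variable [StarModule ℝ A] [ContinuousStar A]

theorem isSelfAdjoint_deriv (hU : IsOpen U) (hp : ∀ t ∈ U, IsSelfAdjoint (p t)) {t : ℝ}
    (ht : t ∈ U) : IsSelfAdjoint (deriv p t) := by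
  have hstar : (fun s => star (p s)) =ᶠ[𝓝 t] p := by
    filter_upwards [hU.mem_nhds ht] with s hs using hp s hs
  rw [IsSelfAdjoint, ← deriv.star, hstar.deriv_eq]

theorem isSelfAdjoint_frameSchwarzian (hU : IsOpen U) (hps : ∀ t ∈ U, IsSelfAdjoint (p t))
    (X : ℝ → A) {u : ℝ} (hu : u ∈ U) : IsSelfAdjoint (frameSchwarzian p X u) := by
  have hps' : ∀ t ∈ U, IsSelfAdjoint (deriv p t) := fun t ht => isSelfAdjoint_deriv hU hps ht
  have hps'' := isSelfAdjoint_deriv hU hps' hu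
  simp only [IsSelfAdjoint, frameSchwarzian, star_smul, star_mul, star_sub, star_star, star_trivial,
    hps''.star_eq, (hps' u hu).star_eq, (hps u hu).ringInverse.star_eq, mul_assoc]

theorem hasDerivAt_star_mul_mul_zero {t : ℝ} {p' : A} (hp : HasDerivAt p p' t)
    (hpu : IsUnit (p t)) (hps : IsSelfAdjoint (p t)) (hps' : IsSelfAdjoint p')
    (hX : HasDerivAt X (-(1 / 2 : ℝ) • (Ring.inverse (p t) * p' * X t)) t)
    (hY : HasDerivAt Y (-(1 / 2 : ℝ) • (Ring.inverse (p t) * p' * Y t)) t) :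
    HasDerivAt (fun s => star (X s) * p s * Y s) 0 t := by
  refine ((hX.star.mul hp).mul hY).congr_deriv ?_
  simp only [star_smul, star_mul, hps'.star_eq, hps.ringInverse.star_eq, star_trivial, Pi.mul_apply,
    add_mul, mul_assoc, smul_mul_assoc, mul_smul_comm, Ring.inverse_mul_cancel_left _ _ hpu,
    Ring.mul_inverse_cancel_left _ _ hpu]
  module

namespace IsParallelFrame

theorem isSelfAdjoint_star_deriv_mul_mul (hX : IsParallelFrame U p X) (hU : IsOpen U)
    (hpu : ∀ u ∈ U, IsUnit (p u)) (hps : ∀ u ∈ U, IsSelfAdjoint (p u)) {u : ℝ} (hu : u ∈ U) :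
    IsSelfAdjoint (star (deriv X u) * p u * X u) := by
  have hval : star (deriv X u) * p u * X u =
      -(1 / 2 : ℝ) • (star (X u) * deriv p u * X u) := by
    rw [← (hps u hu).star_eq, ← star_mul, hX.mul_deriv hpu hu, star_smul, star_mul,
      (isSelfAdjoint_deriv hU hps hu).star_eq, star_trivial, smul_mul_assoc]
  rw [hval]
  exact (IsSelfAdjoint.all _).smul ((isSelfAdjoint_deriv hU hps hu).conjugate' (X u))

theorem exists_eq_mul_right (hX : IsParallelFrame U p X) (hY : IsParallelFrame U p Y)
    (hU : IsOpen U) (hU' : U.OrdConnected) (hp : ∀ u ∈ U, HasDerivAt p (deriv p u) u)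
    (hpu : ∀ u ∈ U, IsUnit (p u)) (hps : ∀ u ∈ U, IsSelfAdjoint (p u)) :
    ∃ R ∈ unitary A, ∀ u ∈ U, Y u = X u * R := by
  rcases U.eq_empty_or_nonempty with rfl | ⟨u₀, hu₀⟩
  · exact ⟨1, one_mem _, by simp⟩
  obtain ⟨R, hR⟩ := exists_forall_eq_of_hasDerivAt_zero hU hU' fun u hu =>
    hasDerivAt_star_mul_mul_zero (hp u hu) (hpu u hu) (hps u hu) (isSelfAdjoint_deriv hU hps hu)
      (hX.hasDerivAt u hu) (hY.hasDerivAt u hu)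
  have hYX : ∀ u ∈ U, Y u = X u * R := fun u hu => by
    rw [← hR u hu, ← mul_assoc, ← mul_assoc, hX.mul_star u hu,
      Ring.inverse_mul_cancel _ (hpu u hu), one_mul]
  have hstarR : star R = star (Y u₀) * p u₀ * X u₀ := by
    rw [← hR u₀ hu₀, star_mul, star_mul, star_star, (hps u₀ hu₀).star_eq, mul_assoc]
  refine ⟨R, Unitary.mem_iff.2 ⟨?_, ?_⟩, hYX⟩
  · rw [hstarR, mul_assoc, ← hYX u₀ hu₀, hY.star_mul_mul hpu hu₀]
  · calc R * star R = star (X u₀) * p u₀ * (Y u₀ * star (Y u₀)) * p u₀ * X u₀ := by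
          rw [hstarR, ← hR u₀ hu₀]
          simp only [mul_assoc]
      _ = 1 := by
          rw [hY.mul_star u₀ hu₀, mul_assoc _ _ (p u₀), Ring.inverse_mul_cancel _ (hpu u₀ hu₀),
            mul_one, hX.star_mul_mul hpu hu₀]

end IsParallelFrame

variable [CompleteSpace A]

theorem exists_isParallelFrame_of_star_mul_mul_eq_one (hU : IsOpen U) (hU' : U.OrdConnected)
    (hp : ContDiffOn ℝ ∞ p U) (hpu : ∀ u ∈ U, IsUnit (p u)) (hps : ∀ u ∈ U, IsSelfAdjoint (p u))
    {u₀ : ℝ} (hu₀ : u₀ ∈ U) {X₀ : A} (hX₀ : IsUnit X₀) (hone : star X₀ * p u₀ * X₀ = 1) :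
    ∃ X, X u₀ = X₀ ∧ IsParallelFrame U p X := by
  obtain ⟨X, hXu₀, hX⟩ := exists_hasDerivAt_mul hU hU' (((contDiffOn_ringInverse hpu hp).mul
    (contDiffOn_deriv hU hp)).const_smul (-(1 / 2 : ℝ))).continuousOn hu₀ X₀
  simp only [smul_mul_assoc] at hX
  have hXc := continuousOn_of_hasDerivAt hX
  obtain ⟨c, hc⟩ := exists_forall_eq_of_hasDerivAt_zero hU hU' fun u hu =>
    hasDerivAt_star_mul_mul_zero (hasDerivAt_deriv_of_contDiffOn hU hp hu) (hpu u hu) (hps u hu)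
      (isSelfAdjoint_deriv hU hps hu) (hX u hu) (hX u hu)
  have hXone : ∀ u ∈ U, star (X u) * p u * X u = 1 := fun u hu => by
    rw [hc u hu, ← hc u₀ hu₀, hXu₀, hone]
  have hXu := isUnit_of_mul_eq_one_of_isPreconnected hU'.isPreconnected hXc
    (hXc.star.mul hp.continuousOn) hXone hu₀ (hXu₀ ▸ hX₀)
  exact ⟨X, hXu₀, hXu, hX, fun u hu =>
    (mul_mul_eq_one_iff_mul_eq_ringInverse (hXu u hu) (hpu u hu)).1 (hXone u hu)⟩

/- Instead of taking a square root of `p⁻¹`, transport `1` in parallel along the path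
`cos² t + sin² t p` from `1` to `p`. -/
theorem exists_isUnit_star_mul_mul_eq_one_of_segment_subset {p : A} (hp : IsSelfAdjoint p)
    (hseg : segment ℝ 1 p ⊆ {x | IsUnit x}) : ∃ x : A, IsUnit x ∧ star x * p * x = 1 := by
  let q : ℝ → A := fun t => (Real.cos t ^ 2) • (1 : A) + (Real.sin t ^ 2) • p
  have hq : ContDiff ℝ ∞ q :=
    ((Real.contDiff_cos.pow 2).smul contDiff_const).add
      ((Real.contDiff_sin.pow 2).smul contDiff_const)
  have hqu : ∀ t, IsUnit (q t) := fun t =>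
    hseg ⟨_, _, sq_nonneg _, sq_nonneg _, Real.cos_sq_add_sin_sq t, rfl⟩
  have hqs : ∀ t, IsSelfAdjoint (q t) := fun t =>
    ((IsSelfAdjoint.all _).smul (.one A)).add ((IsSelfAdjoint.all _).smul hp)
  obtain ⟨X, -, hX⟩ := exists_isParallelFrame_of_star_mul_mul_eq_one isOpen_univ
    Set.ordConnected_univ hq.contDiffOn (fun t _ => hqu t) (fun t _ => hqs t) (Set.mem_univ 0)
    (isUnit_one (M := A)) (by simp [q])
  have hend : q (Real.pi / 2) = p := by simp [q]
  exact ⟨X (Real.pi / 2), hX.isUnit _ trivial, hend ▸ hX.star_mul_mul (fun t _ => hqu t) trivial⟩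

theorem exists_isParallelFrame (hU : IsOpen U) (hU' : U.OrdConnected) (hp : ContDiffOn ℝ ∞ p U)
    (hps : ∀ u ∈ U, IsSelfAdjoint (p u)) (hseg : ∀ u ∈ U, segment ℝ 1 (p u) ⊆ {x | IsUnit x}) :
    ∃ X, IsParallelFrame U p X := by
  rcases U.eq_empty_or_nonempty with rfl | ⟨u₀, hu₀⟩
  · exact ⟨0, by simp, by simp, by simp⟩
  obtain ⟨X₀, hX₀, hone⟩ :=
    exists_isUnit_star_mul_mul_eq_one_of_segment_subset (hps u₀ hu₀) (hseg u₀ hu₀)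
  obtain ⟨X, -, hX⟩ := exists_isParallelFrame_of_star_mul_mul_eq_one hU hU' hp
    (fun u hu => hseg u hu (right_mem_segment ℝ 1 (p u))) hps hu₀ hX₀ hone
  exact ⟨X, hX⟩

end StarBanachAlgebra

/-! ### Bounded bilinear forms -/

section BilinearForm

variable {E : Type*} [NormedAddCommGroup E]

theorem continuous_of_forall_apply_eq [NormedSpace ℝ E] [CompleteSpace E] {b : E →L[ℝ] E →L[ℝ] ℝ}
    (hb : b.toBilinForm.SeparatingRight) (f : (E →L[ℝ] E) →ₗ[ℝ] (E →L[ℝ] E))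
    (hf : ∀ X k l, b (X k) l = b k (f X l)) : Continuous f := by
  have continuous_eval (k : E) : Continuous fun X : E →L[ℝ] E => X k :=
    (ContinuousLinearMap.apply ℝ E k).continuous
  refine f.continuous_of_seq_closed_graph fun X X₀ Y hX hY => ?_
  ext1 l
  refine sub_eq_zero.1 (hb _ fun k => ?_)
  have hleft : Filter.Tendsto (fun n => b (X n k) l) Filter.atTop (𝓝 (b (X₀ k) l)) :=
    (((b.flip l).continuous.comp (continuous_eval k)).tendsto X₀).comp hX
  have hright : Filter.Tendsto (fun n => b k (f (X n) l)) Filter.atTop (𝓝 (b k (Y l))) :=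
    (((b k).continuous.comp (continuous_eval l)).tendsto Y).comp hY
  have hlim : b k (Y l) = b (X₀ k) l :=
    tendsto_nhds_unique hright (hleft.congr fun n => hf (X n) k l)
  simp [hlim, hf]

theorem isCoercive_of_norm_le [NormedSpace ℝ E] {b : E →L[ℝ] E →L[ℝ] ℝ}
    (hb : b.toBilinForm.IsPosSemidef) {C : ℝ} (hC : ∀ x, ‖x‖ ≤ C * ‖b x‖) : IsCoercive b := by
  have hnonneg (x : E) : 0 ≤ b x x := hb.nonneg x
  have norm_apply_sq_le (x : E) : ‖b x‖ ^ 2 ≤ b x x * ‖b‖ := by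
    have hle : ‖b x‖ ≤ √(b x x * ‖b‖) :=
      (b x).opNorm_le_bound (Real.sqrt_nonneg _) fun y => by
        refine abs_le_of_sq_le_sq ?_ (by positivity)
        rw [mul_pow, Real.sq_sqrt (mul_nonneg (hnonneg x) (norm_nonneg b))]
        calc b x y ^ 2 ≤ b x x * b y y :=
              LinearMap.BilinForm.apply_sq_le_of_symm _ hb.nonneg
                (LinearMap.BilinForm.isSymm_iff.1 hb.isSymm) x y
          _ ≤ b x x * (‖b‖ * ‖y‖ * ‖y‖) :=
              mul_le_mul_of_nonneg_left ((le_abs_self _).trans (b.le_opNorm₂ y y)) (hnonneg x)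
          _ = b x x * ‖b‖ * ‖y‖ ^ 2 := by ring
    calc ‖b x‖ ^ 2 ≤ √(b x x * ‖b‖) ^ 2 := by gcongr
      _ = b x x * ‖b‖ := Real.sq_sqrt (mul_nonneg (hnonneg x) (norm_nonneg b))
  have hpos : 0 < C ^ 2 * ‖b‖ + 1 := by positivity
  refine ⟨(C ^ 2 * ‖b‖ + 1)⁻¹, inv_pos.2 hpos, fun x => ?_⟩
  rw [mul_assoc, inv_mul_le_iff₀ hpos]
  calc ‖x‖ * ‖x‖ ≤ (C * ‖b x‖) * (C * ‖b x‖) :=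
        mul_self_le_mul_self (norm_nonneg x) (hC x)
    _ = C ^ 2 * ‖b x‖ ^ 2 := by ring
    _ ≤ C ^ 2 * (b x x * ‖b‖) := by gcongr; exact norm_apply_sq_le x
    _ ≤ (C ^ 2 * ‖b‖ + 1) * b x x := by linarith [hnonneg x]

variable [InnerProductSpace ℝ E] [CompleteSpace E] {b : E →L[ℝ] E →L[ℝ] ℝ} {X : E →L[ℝ] E}

theorem isUnit_of_isCoercive_comp (hb : IsCoercive b) (hX : IsCoercive (b ∘L X)) : IsUnit X := by
  have hcomp : ⇑X = hb.continuousLinearEquivOfBilin.symm ∘ hX.continuousLinearEquivOfBilin := by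
    funext k
    rw [Function.comp_apply, ContinuousLinearEquiv.eq_symm_apply]
    exact ext_inner_right ℝ fun l => by simp
  rw [ContinuousLinearMap.isUnit_iff_bijective, hcomp]
  exact (ContinuousLinearEquiv.bijective _).comp (ContinuousLinearEquiv.bijective _)

theorem segment_one_subset_isUnit (hb : IsCoercive b) (hX : IsUnit X)
    (hpos : ∀ k, 0 ≤ b (X k) k) : segment ℝ 1 X ⊆ {W | IsUnit W} := by
  obtain ⟨c, hc, hcb⟩ := id hb
  rintro _ ⟨s, t, hs, ht, hst, rfl⟩
  rcases hs.eq_or_lt with rfl | hs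
  · obtain rfl : t = 1 := by linarith
    rwa [zero_smul, zero_add, one_smul]
  refine isUnit_of_isCoercive_comp hb ⟨s * c, mul_pos hs hc, fun k => ?_⟩
  calc s * c * ‖k‖ * ‖k‖ = s * (c * ‖k‖ * ‖k‖) := by ring
    _ ≤ s * b k k + t * b (X k) k :=
      le_add_of_le_of_nonneg (mul_le_mul_of_nonneg_left (hcb k) hs.le) (mul_nonneg ht (hpos k))
    _ = (b ∘L (s • 1 + t • X)) k k := by simp

end BilinearForm

/-! ### Reflections and the Maurer–Cartan form -/

theorem maurerCartan_eq_iff {T : Type*} [NormedAddCommGroup T] [InnerProductSpace ℝ T]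
    {M : ℝ → T →L[ℝ] T} {u : ℝ} (hM : IsUnit (M u)) {Θ : T →L[ℝ] T} :
    maurerCartan M u = Θ ↔ deriv M u = M u * Θ := by
  rw [maurerCartan]
  constructor
  · rintro rfl
    rw [Ring.mul_inverse_cancel_left _ _ hM]
  · intro h
    rw [h, Ring.inverse_mul_cancel_left _ _ hM]

theorem reflection_add {T : Type*} [NormedAddCommGroup T] [InnerProductSpace ℝ T]
    {A B : Submodule ℝ T} (h : A.IsTopCompl B) {a b : T} (ha : a ∈ A) (hb : b ∈ B) :
    reflection A B (a + b) = a - b := by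
  lift a to A using ha
  lift b to B using hb
  simp [reflection, h]

variable {T : Type*} [NormedAddCommGroup T] [InnerProductSpace ℝ T] [CompleteSpace T]

/-! ### The symplectic form and the inner product of a hyperbolic structure -/

namespace SymplecticStructure

variable (S : SymplecticStructure T)

theorem form_swap (x y : T) : S.form x y = -S.form y x := by
  rw [form, form, ← ContinuousLinearMap.adjoint_inner_left, S.adjoint_eq, neg_apply,
    inner_neg_left, real_inner_comm]

theorem form_add_left (x y z : T) : S.form (x + y) z = S.form x z + S.form y z := by
  simp [form, inner_add_left]

theorem form_add_right (x y z : T) : S.form x (y + z) = S.form x y + S.form x z := by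
  simp [form, inner_add_right]

theorem adjoint_comp_Om_comp_eq_iff (g : T →L[ℝ] T) :
    ContinuousLinearMap.adjoint g ∘L S.Om ∘L g = S.Om ↔ ∀ x y, S.form (g x) (g y) = S.form x y := by
  constructor
  · intro h x y
    have hxy := congrArg (fun F : T →L[ℝ] T => inner ℝ x (F y)) h
    simpa [ContinuousLinearMap.adjoint_inner_right, form] using hxy
  · intro h
    ext y
    refine ext_inner_left ℝ fun x => ?_
    simpa [ContinuousLinearMap.adjoint_inner_right, form] using h x y

theorem isCanonical_iff {g : T →L[ℝ] T} :
    S.IsCanonical g ↔ IsUnit g ∧ ∀ x y, S.form (g x) (g y) = S.form x y := by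
  rw [IsCanonical, ← ContinuousLinearMap.isUnit_iff_bijective, adjoint_comp_Om_comp_eq_iff]

variable {S} in
theorem IsCanonical.mul {g h : T →L[ℝ] T} (hg : S.IsCanonical g) (hh : S.IsCanonical h) :
    S.IsCanonical (g * h) := by
  rw [isCanonical_iff] at *
  exact ⟨hg.1.mul hh.1, fun x y => (hg.2 _ _).trans (hh.2 x y)⟩

end SymplecticStructure

namespace HyperbolicStructure

variable {S : SymplecticStructure T} (P : HyperbolicStructure S)

theorem form_J_J (x y : T) : S.form (P.J x) (P.J y) = S.form x y :=
  (S.adjoint_comp_Om_comp_eq_iff P.J).1 P.canonical x y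

theorem form_K_K (x y : T) : S.form (P.K x) (P.K y) = -S.form x y := by
  have h := congrArg (fun F : T →L[ℝ] T => inner ℝ x (F y)) P.anticanonical
  simpa [ContinuousLinearMap.adjoint_inner_right, SymplecticStructure.form] using h

/-- The inner product `ω(J x, y)` as a bounded bilinear form. -/
def gL : T →L[ℝ] T →L[ℝ] ℝ := (innerSL ℝ).bilinearComp P.J S.Om

theorem gL_apply (x y : T) : P.gL x y = P.g x y := rfl

theorem g_add_left (x y z : T) : P.g (x + y) z = P.g x z + P.g y z := by simp [← gL_apply]

theorem g_add_right (x y z : T) : P.g x (y + z) = P.g x y + P.g x z := by simp [← gL_apply]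

theorem g_sub_left (x y z : T) : P.g (x - y) z = P.g x z - P.g y z := by simp [← gL_apply]

@[simp] theorem g_neg_right (x y : T) : P.g x (-y) = -P.g x y := by simp [← gL_apply]

theorem g_smul_left (c : ℝ) (x y : T) : P.g (c • x) y = c * P.g x y := by simp [← gL_apply]

theorem g_smul_right (c : ℝ) (x y : T) : P.g x (c • y) = c * P.g x y := by simp [← gL_apply]

@[simp] theorem g_zero_left (x : T) : P.g 0 x = 0 := by simp [← gL_apply]

@[simp] theorem g_zero_right (x : T) : P.g x 0 = 0 := by simp [← gL_apply]

theorem isPosSemidef_gL : P.gL.toBilinForm.IsPosSemidef where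
  eq := P.g_comm
  nonneg x := by
    rcases eq_or_ne x 0 with rfl | hx
    · simp
    · exact (P.g_self_pos hx).le

theorem isCoercive_gL : IsCoercive P.gL := by
  let Z : T →L[ℝ] T := -(P.J ∘L S.Om)
  have hg (x : T) : P.g x (Z x) = ‖x‖ * ‖x‖ := by
    have hOm : S.Om (S.Om x) = -x := congrArg (fun F : T →L[ℝ] T => F x) S.sq_eq
    have hZ : Z x = P.J (-S.Om x) := by simp [Z]
    rw [hZ, g, form_J_J, SymplecticStructure.form, map_neg, hOm, neg_neg,
      real_inner_self_eq_norm_mul_norm]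
  refine isCoercive_of_norm_le P.isPosSemidef_gL (C := ‖Z‖) fun x => ?_
  rcases eq_or_ne x 0 with rfl | hx
  · simp
  refine le_of_mul_le_mul_right ?_ (norm_pos_iff.2 hx)
  calc ‖x‖ * ‖x‖ = P.gL x (Z x) := (hg x).symm
    _ ≤ ‖P.gL x‖ * ‖Z x‖ := (le_abs_self _).trans ((P.gL x).le_opNorm _)
    _ ≤ ‖P.gL x‖ * (‖Z‖ * ‖x‖) := by gcongr; exact Z.le_opNorm x
    _ = ‖Z‖ * ‖P.gL x‖ * ‖x‖ := by ring

/-- The restriction to `K₊` of the inner product `ω(J x, y)`. -/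
def plusForm : P.plus →L[ℝ] P.plus →L[ℝ] ℝ := P.gL.bilinearComp P.plus.subtypeL P.plus.subtypeL

theorem isCoercive_plusForm : IsCoercive P.plusForm :=
  let ⟨c, hc, h⟩ := P.isCoercive_gL
  ⟨c, hc, fun k => h k⟩

theorem ext_g {k l : P.plus} (h : ∀ m : P.plus, P.g k m = P.g l m) : k = l := by
  by_contra hne
  have hpos := P.g_self_pos (x := (k : T) - l) (sub_ne_zero.2 fun h => hne (Subtype.ext h))
  have heq := h (k - l)
  rw [Submodule.coe_sub] at heq
  rw [g_sub_left, heq, sub_self] at hpos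
  exact hpos.false

theorem separatingRight_plusForm : P.plusForm.toBilinForm.SeparatingRight := fun l h =>
  P.ext_g fun m => by
    rw [P.g_comm, P.g_comm _ m, Submodule.coe_zero, g_zero_right]
    exact h m

theorem completeSpace_plus : CompleteSpace P.plus :=
  (ContinuousLinearMap.isClosed_ker (ContinuousLinearMap.id ℝ T - P.K)).completeSpace_coe

theorem segment_one_subset_isUnit {X : P.plus →L[ℝ] P.plus} (hX : IsUnit X)
    (hpos : ∀ k : P.plus, 0 ≤ P.g (X k) k) : segment ℝ 1 X ⊆ {W | IsUnit W} :=
  have := P.completeSpace_plus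
  LagrangeLift.segment_one_subset_isUnit P.isCoercive_plusForm hX hpos

theorem g_apply_self_pos {X : P.plus →L[ℝ] P.plus} (hX : IsUnit X) (hadj : P.adj X = X)
    (hpos : ∀ k : P.plus, 0 ≤ P.g (X k) k) {k : P.plus} (hk : k ≠ 0) : 0 < P.g (X k) k := by
  let b := (P.plusForm ∘L X).toBilinForm
  have hsymm : b.IsSymm := ⟨fun k l => by
    change P.g (X k) l = P.g (X l) k
    rw [P.g_adj, hadj, P.g_comm]⟩
  refine lt_of_le_of_ne (hpos k) fun h0 => hk ?_
  have hker : b k = 0 := (b.apply_apply_same_eq_zero_iff hpos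
    (LinearMap.BilinForm.isSymm_iff.1 hsymm)).1 h0.symm
  have hXk : X k = 0 := P.ext_g fun m => (congrArg (· m) hker).trans (P.g_zero_left m).symm
  obtain ⟨Y, hYX⟩ := hX.exists_left_inv
  rw [← one_apply_eq_self k (F := P.plus →L[ℝ] P.plus), ← hYX, mul_apply_eq_comp, hXk, map_zero]

/-! ### The star algebra of operators on `K₊` -/

theorem g_adj' (X : P.plus →L[ℝ] P.plus) (k l : P.plus) : P.g (P.adj X k) l = P.g k (X l) := by
  rw [P.g_comm, ← P.g_adj, P.g_comm]

/-- The involution of the algebra of bounded operators on `K₊` given by the adjoint for the inner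
product `ω(J x, y)`. It is activated locally, since it depends on the hyperbolic structure and
differs from the adjoint for the inner product of `T`. -/
abbrev starRing : StarRing (P.plus →L[ℝ] P.plus) where
  star := P.adj
  star_involutive X := (P.eq_adj _ _ fun k l => P.g_adj' X k l).symm
  star_mul X Y := (P.eq_adj _ _ fun k l => by simp only [mul_apply_eq_comp, g_adj]).symm
  star_add X Y := (P.eq_adj _ _ fun k l => by
    simp only [add_apply, Submodule.coe_add, g_add_left, g_add_right, g_adj]).symm

attribute [local instance] starRing

theorem star_eq_adj (X : P.plus →L[ℝ] P.plus) : star X = P.adj X := rfl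

instance : StarModule ℝ (P.plus →L[ℝ] P.plus) where
  star_smul c X := (P.eq_adj _ _ fun k l => by
    simp [g_smul_left, g_smul_right, star_eq_adj, g_adj]).symm

instance : ContinuousStar (P.plus →L[ℝ] P.plus) where
  continuous_star := by
    let f : (P.plus →L[ℝ] P.plus) →ₗ[ℝ] (P.plus →L[ℝ] P.plus) :=
      { toFun := star, map_add' := star_add, map_smul' := star_smul }
    have := P.completeSpace_plus
    exact continuous_of_forall_apply_eq P.separatingRight_plusForm f P.g_adj

instance : CompleteSpace (P.plus →L[ℝ] P.plus) :=
  have := P.completeSpace_plus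
  inferInstance

theorem isSelfAdjoint_iff {X : P.plus →L[ℝ] P.plus} : IsSelfAdjoint X ↔ P.adj X = X := Iff.rfl

theorem isOrthogonal_iff_mem_unitary {R : P.plus →L[ℝ] P.plus} :
    P.IsOrthogonal R ↔ R ∈ unitary (P.plus →L[ℝ] P.plus) := by
  rw [Unitary.mem_iff, star_eq_adj]
  constructor
  · rintro ⟨hsurj, hg⟩
    have hadj : P.adj R * R = 1 := by
      ext1 k
      refine P.ext_g fun l => ?_
      rw [mul_apply_eq_comp, g_adj', hg, one_apply_eq_self]
    refine ⟨hadj, ContinuousLinearMap.ext fun k => ?_⟩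
    obtain ⟨l, rfl⟩ := hsurj k
    rw [← mul_apply_eq_comp, mul_assoc, hadj, mul_one, one_apply_eq_self]
  · rintro ⟨hleft, hright⟩
    refine ⟨fun k => ⟨P.adj R k, ?_⟩, fun k l => ?_⟩
    · rw [← mul_apply_eq_comp, hright, one_apply_eq_self]
    · rw [g_adj, ← mul_apply_eq_comp, hleft, one_apply_eq_self]

theorem isFrame_iff_isParallelFrame {U : Set ℝ} {H X : ℝ → P.plus →L[ℝ] P.plus} :
    P.IsFrame U H X ↔ IsParallelFrame U (deriv H) X := by
  have hdd : iteratedDeriv 2 H = deriv (deriv H) := by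
    rw [iteratedDeriv_succ, iteratedDeriv_one]
  refine ⟨fun h => ⟨h.isUnit, fun u hu => ?_, h.mul_adj⟩,
    fun h => ⟨h.isUnit, fun u hu => ?_, h.mul_star⟩⟩
  · rw [← hdd]
    exact h.hasDerivAt u hu
  · rw [hdd]
    exact h.hasDerivAt u hu

theorem schwarzian_eq_frameSchwarzian (H X : ℝ → P.plus →L[ℝ] P.plus) (u : ℝ) :
    P.schwarzian H X u = frameSchwarzian (deriv H) X u := by
  simp only [schwarzian, frameSchwarzian, iteratedDeriv_succ, iteratedDeriv_zero, star_eq_adj]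

/-! ### Block matrices -/

-- A shortcut: `simp` does not find this instance by itself.
instance : HasDistribNeg (P.plus →L[ℝ] P.plus) := inferInstance

theorem fst_add_J_snd (x : T) : (P.fst x : T) + P.J (P.snd x) = x := P.split.symm_apply_apply x

theorem fst_split_symm (k l : P.plus) : P.fst (k + P.J l) = k :=
  congrArg Prod.fst (P.split.apply_symm_apply (k, l))

theorem snd_split_symm (k l : P.plus) : P.snd (k + P.J l) = l :=
  congrArg Prod.snd (P.split.apply_symm_apply (k, l))

theorem ext_fst_snd {x y : T} (hfst : P.fst x = P.fst y) (hsnd : P.snd x = P.snd y) : x = y := by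
  rw [← P.fst_add_J_snd x, hfst, hsnd, fst_add_J_snd]

@[simp] theorem fst_coe (k : P.plus) : P.fst (k : T) = k := by
  simpa using P.fst_split_symm k 0

@[simp] theorem snd_coe (k : P.plus) : P.snd (k : T) = 0 := by
  simpa using P.snd_split_symm k 0

@[simp] theorem fst_J (k : P.plus) : P.fst (P.J k) = 0 := by
  simpa using P.fst_split_symm 0 k

@[simp] theorem snd_J (k : P.plus) : P.snd (P.J k) = k := by
  simpa using P.snd_split_symm 0 k

@[simp] theorem fst_block (A B C D : P.plus →L[ℝ] P.plus) (x : T) :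
    P.fst (P.block A B C D x) = A (P.fst x) + B (P.snd x) := P.fst_split_symm _ _

@[simp] theorem snd_block (A B C D : P.plus →L[ℝ] P.plus) (x : T) :
    P.snd (P.block A B C D x) = C (P.fst x) + D (P.snd x) := P.snd_split_symm _ _

theorem eq_block (F : T →L[ℝ] T) : F = P.block (P.fst ∘L F ∘L P.plus.subtypeL)
    (P.fst ∘L F ∘L P.J ∘L P.plus.subtypeL) (P.snd ∘L F ∘L P.plus.subtypeL)
    (P.snd ∘L F ∘L P.J ∘L P.plus.subtypeL) := by
  ext1 x
  apply P.ext_fst_snd <;> simp [← map_add, fst_add_J_snd]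

theorem block_inj {A B C D A' B' C' D' : P.plus →L[ℝ] P.plus} :
    P.block A B C D = P.block A' B' C' D' ↔ A = A' ∧ B = B' ∧ C = C' ∧ D = D' := by
  refine ⟨fun h => ?_, by rintro ⟨rfl, rfl, rfl, rfl⟩; rfl⟩
  have hcoe (k : P.plus) : P.block A B C D k = P.block A' B' C' D' k := by rw [h]
  have hJ (k : P.plus) : P.block A B C D (P.J k) = P.block A' B' C' D' (P.J k) := by rw [h]
  refine ⟨?_, ?_, ?_, ?_⟩ <;> ext1 k
  · simpa using congrArg P.fst (hcoe k)
  · simpa using congrArg P.fst (hJ k)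
  · simpa using congrArg P.snd (hcoe k)
  · simpa using congrArg P.snd (hJ k)

theorem block_one : P.block 1 0 0 1 = 1 := by
  ext1 x
  apply P.ext_fst_snd <;> simp

theorem block_mul_block (A B C D A' B' C' D' : P.plus →L[ℝ] P.plus) :
    P.block A B C D * P.block A' B' C' D' =
      P.block (A * A' + B * C') (A * B' + B * D') (C * A' + D * C') (C * B' + D * D') := by
  ext1 x
  apply P.ext_fst_snd <;>
    simp only [mul_apply_eq_comp, fst_block, snd_block, add_apply, map_add] <;> abel

theorem block_add_block (A B C D A' B' C' D' : P.plus →L[ℝ] P.plus) :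
    P.block A B C D + P.block A' B' C' D' = P.block (A + A') (B + B') (C + C') (D + D') := by
  ext1 x
  apply P.ext_fst_snd <;> simp only [fst_block, snd_block, add_apply, map_add] <;> abel

theorem isUnit_block_lowerTriangular {a d : P.plus →L[ℝ] P.plus} (ha : IsUnit a) (hd : IsUnit d)
    (c : P.plus →L[ℝ] P.plus) : IsUnit (P.block a 0 c d) := by
  obtain ⟨a, rfl⟩ := ha
  obtain ⟨d, rfl⟩ := hd
  refine ⟨⟨P.block a 0 c d, P.block ↑a⁻¹ 0 (-(↑d⁻¹ * c * ↑a⁻¹)) ↑d⁻¹, ?_, ?_⟩, rfl⟩ <;>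
    simp [block_mul_block, mul_assoc, ← P.block_one]

theorem block_eq (A B C D : P.plus →L[ℝ] P.plus) :
    P.block A B C D = P.plus.subtypeL ∘L A ∘L P.fst + P.plus.subtypeL ∘L B ∘L P.snd +
      ((P.J ∘L P.plus.subtypeL) ∘L C ∘L P.fst + (P.J ∘L P.plus.subtypeL) ∘L D ∘L P.snd) := by
  ext1 x
  apply P.ext_fst_snd <;> simp

theorem contDiffOn_block {a b c d : ℝ → P.plus →L[ℝ] P.plus} {U : Set ℝ} {n : WithTop ℕ∞}
    (ha : ContDiffOn ℝ n a U) (hb : ContDiffOn ℝ n b U) (hc : ContDiffOn ℝ n c U)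
    (hd : ContDiffOn ℝ n d U) :
    ContDiffOn ℝ n (fun t => P.block (a t) (b t) (c t) (d t)) U := by
  have entry {x : ℝ → P.plus →L[ℝ] P.plus} (hx : ContDiffOn ℝ n x U) (f : P.plus →L[ℝ] T)
      (i : T →L[ℝ] P.plus) : ContDiffOn ℝ n (fun t => f ∘L x t ∘L i) U :=
    contDiffOn_const.clm_comp (hx.clm_comp contDiffOn_const)
  simp only [block_eq]
  exact ((entry ha _ _).add (entry hb _ _)).add ((entry hc _ _).add (entry hd _ _))

theorem exists_contDiffOn_eq_block {F : ℝ → T →L[ℝ] T} {U : Set ℝ} {n : WithTop ℕ∞}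
    (hF : ContDiffOn ℝ n F U) : ∃ a b c d : ℝ → P.plus →L[ℝ] P.plus,
      ContDiffOn ℝ n a U ∧ ContDiffOn ℝ n c U ∧ ContDiffOn ℝ n d U ∧
        ∀ t, F t = P.block (a t) (b t) (c t) (d t) := by
  have entry {f : T →L[ℝ] P.plus} {i : P.plus →L[ℝ] T} :
      ContDiffOn ℝ n (fun t => f ∘L F t ∘L i) U :=
    contDiffOn_const.clm_comp (hF.clm_comp contDiffOn_const)
  exact ⟨_, _, _, _, entry, entry, entry, fun t => P.eq_block (F t)⟩

theorem hasDerivAt_block {a b c d : ℝ → P.plus →L[ℝ] P.plus} {a' b' c' d' : P.plus →L[ℝ] P.plus}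
    {u : ℝ} (ha : HasDerivAt a a' u) (hb : HasDerivAt b b' u) (hc : HasDerivAt c c' u)
    (hd : HasDerivAt d d' u) :
    HasDerivAt (fun t => P.block (a t) (b t) (c t) (d t)) (P.block a' b' c' d') u := by
  have entry {x : ℝ → P.plus →L[ℝ] P.plus} {x' : P.plus →L[ℝ] P.plus} (hx : HasDerivAt x x' u)
      (f : P.plus →L[ℝ] T) (i : T →L[ℝ] P.plus) :
      HasDerivAt (fun t => f ∘L x t ∘L i) (f ∘L x' ∘L i) u :=
    hasDerivAt_comp_comp hx f i
  simp only [block_eq]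
  exact ((entry ha _ _).fun_add (entry hb _ _)).fun_add ((entry hc _ _).fun_add (entry hd _ _))

/-! ### Symplectic block matrices -/

theorem form_plus (k l : P.plus) : S.form k l = 0 := by
  have h := P.form_K_K k l
  rw [P.mem_plus.1 k.2, P.mem_plus.1 l.2] at h
  linarith

theorem form_eq (x y : T) : S.form x y = P.g (P.snd x) (P.fst y) - P.g (P.fst x) (P.snd y) := by
  have hJ (k l : P.plus) : S.form k (P.J l) = -P.g k l := by
    rw [S.form_swap, P.g_comm, g]
  nth_rw 1 [← P.fst_add_J_snd x, ← P.fst_add_J_snd y]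
  rw [S.form_add_left, S.form_add_right, S.form_add_right, form_plus, form_J_J, form_plus, hJ, g, g]
  ring

theorem form_block_apply (A B C D : P.plus →L[ℝ] P.plus) (x y : T) :
    S.form (P.block A B C D x) y = S.form x (P.block (star D) (-star B) (-star C) (star A) y) := by
  simp only [P.form_eq, fst_block, snd_block, Submodule.coe_add, g_add_left, g_add_right, g_adj,
    neg_apply, Submodule.coe_neg, g_neg_right, star_eq_adj]
  ring

theorem isCanonical_block_iff {A B C D : P.plus →L[ℝ] P.plus} :
    S.IsCanonical (P.block A B C D) ↔ IsUnit (P.block A B C D) ∧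
      P.block (star D) (-star B) (-star C) (star A) * P.block A B C D = 1 := by
  rw [S.isCanonical_iff, and_congr_right_iff]
  intro
  simp only [P.form_block_apply, ← mul_apply_eq_comp]
  refine ⟨fun h => ?_, fun h x y => by rw [h, one_apply_eq_self]⟩
  ext1 y
  exact P.ext_fst_snd (P.ext_g fun m => by simpa [P.form_eq, P.g_comm _ (m : T)] using h (P.J m) y)
    (P.ext_g fun m => by simpa [P.form_eq, P.g_comm _ (m : T)] using h m y)

theorem isCanonical_block_lowerTriangular {a c d : P.plus →L[ℝ] P.plus} (ha : IsUnit a)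
    (hd : IsUnit d) (hda : star d * a = 1) (hca : IsSelfAdjoint (star c * a)) :
    S.IsCanonical (P.block a 0 c d) := by
  have had : star a * d = 1 := by simpa using congrArg star hda
  have hac : star a * c = star c * a := by simpa using hca.star_eq
  refine P.isCanonical_block_iff.2 ⟨P.isUnit_block_lowerTriangular ha hd c, ?_⟩
  simp [block_mul_block, hda, had, hac, ← P.block_one]

theorem star_mul_eq_one_and_isUnit_of_isCanonical {a c d : P.plus →L[ℝ] P.plus}
    (h : S.IsCanonical (P.block a 0 c d)) : star d * a = 1 ∧ IsUnit d := by
  obtain ⟨hunit, hone⟩ := P.isCanonical_block_iff.1 h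
  rw [block_mul_block, ← P.block_one, block_inj] at hone
  have hda : star d * a = 1 := by simpa using hone.1
  obtain ⟨G, hG⟩ := hunit.exists_right_inv
  rw [P.eq_block G, block_mul_block, ← P.block_one, block_inj, zero_mul, add_zero] at hG
  have hd : IsUnit (star d) := ⟨⟨star d, a, hda, by
    rw [left_inv_eq_right_inv hda hG.1, hG.1]⟩, rfl⟩
  exact ⟨hda, by simpa using hd.star⟩

/-! ### Lagrangian subspaces and graphs -/

theorem mem_minus_iff_fst {x : T} : x ∈ P.minus ↔ P.fst x = 0 := by
  rw [mem_minus, ← Subtype.coe_inj, coe_fst, Submodule.coe_zero, smul_eq_zero_iff_right (by simp),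
    add_comm, add_eq_zero_iff_eq_neg]

theorem isLagrangian_minus : S.IsLagrangian P.minus := by
  refine ⟨fun x hx y hy => ?_, fun Y hY hle y hy => ?_⟩
  · rw [mem_minus_iff_fst] at hx hy
    simp [P.form_eq, hx, hy]
  · rw [mem_minus_iff_fst]
    refine P.ext_g fun m => ?_
    have hm : P.J m ∈ P.minus := P.mem_minus_iff_fst.2 (P.fst_J m)
    simpa [P.form_eq] using hY y hy _ (hle hm)

theorem mem_graph {H : P.plus →L[ℝ] P.plus} {x : T} :
    x ∈ P.graph H ↔ P.fst x = H (P.snd x) := by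
  constructor
  · rintro ⟨k, rfl⟩
    simp
  · intro h
    refine ⟨P.snd x, ?_⟩
    apply P.ext_fst_snd <;> simp [h]

/-- The shear `[[1, H], [0, 1]]`. It carries `K₋` to the graph of `H`, so that every lift of a curve
of graphs is a shear times a lower triangular block matrix. -/
def shear (H : P.plus →L[ℝ] P.plus) : T →L[ℝ] T := P.block 1 H 0 1

theorem shear_mul_shear_neg (H : P.plus →L[ℝ] P.plus) : P.shear H * P.shear (-H) = 1 := by
  simp [shear, block_mul_block, ← P.block_one]

theorem isUnit_shear (H : P.plus →L[ℝ] P.plus) : IsUnit (P.shear H) :=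
  ⟨⟨P.shear H, P.shear (-H), P.shear_mul_shear_neg H, by
    simpa using P.shear_mul_shear_neg (-H)⟩, rfl⟩

theorem isCanonical_shear {H : P.plus →L[ℝ] P.plus} (hH : IsSelfAdjoint H) :
    S.IsCanonical (P.shear H) := by
  refine P.isCanonical_block_iff.2 ⟨P.isUnit_shear H, ?_⟩
  simp [block_mul_block, hH.star_eq, ← P.block_one]

theorem shear_apply_mem_graph_iff {H : P.plus →L[ℝ] P.plus} {x : T} :
    P.shear H x ∈ P.graph H ↔ x ∈ P.minus := by
  simp [mem_graph, mem_minus_iff_fst, shear]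

theorem hasDerivAt_shear_mul_block {H a c d : ℝ → P.plus →L[ℝ] P.plus}
    {p a' c' d' : P.plus →L[ℝ] P.plus} {u : ℝ} (hH : HasDerivAt H p u) (ha : HasDerivAt a a' u)
    (hc : HasDerivAt c c' u) (hd : HasDerivAt d d' u) :
    HasDerivAt (fun t => P.shear (H t) * P.block (a t) 0 (c t) (d t))
      (P.shear (H u) * P.block (a' + p * c u) (p * d u) c' d') u := by
  have hshear : HasDerivAt (fun t => P.shear (H t)) (P.block 0 p 0 0) u :=
    P.hasDerivAt_block (hasDerivAt_const u (1 : P.plus →L[ℝ] P.plus)) hH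
      (hasDerivAt_const u (0 : P.plus →L[ℝ] P.plus)) (hasDerivAt_const u (1 : P.plus →L[ℝ] P.plus))
  have hblock := P.hasDerivAt_block ha (hasDerivAt_const u (0 : P.plus →L[ℝ] P.plus)) hc hd
  refine (hshear.mul hblock).congr_deriv ?_
  simp only [shear, block_mul_block, block_add_block, block_inj, zero_mul, one_mul, zero_add,
    add_zero, and_true]
  abel

/-! ### Lifts -/

section Lift

variable {U : Set ℝ} {H X : ℝ → P.plus →L[ℝ] P.plus} {HH : ℝ → Submodule ℝ T}

theorem lift_eq_shear_mul {u : ℝ} (hH : HasDerivAt H (deriv H u) u)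
    (hX : HasDerivAt X (deriv X u) u) : P.lift H X u =
      P.shear (H u) * P.block (deriv H u * X u) 0 (deriv X u) (X u) := by
  have hY : deriv (fun t => H t * X t) u = deriv H u * X u + H u * deriv X u :=
    (hH.clm_comp hX).deriv
  rw [lift, hY, shear, block_mul_block]
  simp [add_comm]

theorem lift_mul_right {Y : ℝ → P.plus →L[ℝ] P.plus} {R : P.plus →L[ℝ] P.plus} (hU : IsOpen U)
    (hXY : ∀ u ∈ U, Y u = X u * R) {u : ℝ} (hu : u ∈ U) (hH : HasDerivAt H (deriv H u) u)
    (hX : HasDerivAt X (deriv X u) u) : P.lift H Y u = P.lift H X u * P.block R 0 0 R := by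
  obtain ⟨hY, hY'⟩ :=
    hasDerivAt_deriv_and_deriv_eq_of_eq_mul_right (A := P.plus →L[ℝ] P.plus) hU hXY hu hX
  rw [P.lift_eq_shear_mul hH hY, P.lift_eq_shear_mul hH hX, hY', hXY u hu, mul_assoc,
    block_mul_block]
  simp only [mul_assoc, mul_zero, zero_mul, add_zero, zero_add]

theorem isLift_lift (hU : IsOpen U) (hH : ContDiffOn ℝ ∞ H U)
    (hHs : ∀ u ∈ U, IsSelfAdjoint (H u)) (hH' : ∀ u ∈ U, IsUnit (deriv H u))
    (hHH : ∀ u ∈ U, HH u = P.graph (H u)) (hX : IsParallelFrame U (deriv H) X) :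
    S.IsLift U HH P.minus (P.lift H X) := by
  have hp := contDiffOn_deriv hU hH
  have hps (u) (hu : u ∈ U) : IsSelfAdjoint (deriv H u) :=
    isSelfAdjoint_deriv (A := P.plus →L[ℝ] P.plus) hU hHs hu
  have hXc := hX.contDiffOn hU hp hH'
  have hM (u) (hu : u ∈ U) := P.lift_eq_shear_mul (hasDerivAt_deriv_of_contDiffOn hU hH hu)
    (hasDerivAt_deriv_of_contDiffOn hU hXc hu)
  have hpX (u) (hu : u ∈ U) : IsUnit (deriv H u * X u) := (hH' u hu).mul (hX.isUnit u hu)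
  refine ⟨?_, fun u hu => ?_, P.isLagrangian_minus, fun u hu => ?_⟩
  · exact P.contDiffOn_block (contDiffOn_deriv hU (hH.mul hXc)) (hH.mul hXc)
      (contDiffOn_deriv hU hXc) hXc
  · rw [hM u hu]
    refine (P.isCanonical_shear (hHs u hu)).mul
      (P.isCanonical_block_lowerTriangular (hpX u hu) (hX.isUnit u hu) ?_ ?_)
    · rw [← mul_assoc, hX.star_mul_mul hH' hu]
    · rw [← mul_assoc]
      exact hX.isSelfAdjoint_star_deriv_mul_mul hU hH' hps hu
  · ext x
    rw [hHH u hu, hM u hu]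
    have := P.completeSpace_plus
    have hinj := (ContinuousLinearMap.isUnit_iff_bijective.1 (hpX u hu)).1
    have hmem : P.shear (H u) (P.block (deriv H u * X u) 0 (deriv X u) (X u) x) ∈ P.graph (H u) ↔
        x ∈ P.minus := by
      rw [shear_apply_mem_graph_iff, mem_minus_iff_fst, mem_minus_iff_fst, fst_block, zero_apply,
        add_zero, map_eq_zero_iff _ hinj]
    exact hmem

theorem maurerCartan_lift (hU : IsOpen U) (hH : ContDiffOn ℝ ∞ H U)
    (hH' : ∀ u ∈ U, IsUnit (deriv H u))
    (hX : IsParallelFrame U (deriv H) X) {u : ℝ} (hu : u ∈ U) :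
    maurerCartan (P.lift H X) u =
      P.block 0 1 (-(1 / 2 : ℝ) • frameSchwarzian (deriv H) X u) 0 := by
  have hp := contDiffOn_deriv hU hH
  have hHd (t) (ht : t ∈ U) := hasDerivAt_deriv_of_contDiffOn hU hH ht
  have hpd (t) (ht : t ∈ U) := hasDerivAt_deriv_of_contDiffOn hU hp ht
  have hXd (t) (ht : t ∈ U) :=
    hasDerivAt_deriv_of_contDiffOn hU (hX.contDiffOn hU hp hH') ht
  have hM (t) (ht : t ∈ U) := P.lift_eq_shear_mul (hHd t ht) (hXd t ht)
  have hunit : IsUnit (P.lift H X u) := by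
    rw [hM u hu]
    exact (P.isUnit_shear _).mul
      (P.isUnit_block_lowerTriangular ((hH' u hu).mul (hX.isUnit u hu)) (hX.isUnit u hu) _)
  rw [maurerCartan_eq_iff hunit, (Filter.eventuallyEq_of_mem (hU.mem_nhds hu) hM).deriv_eq,
    (P.hasDerivAt_shear_mul_block (hHd u hu) (hX.hasDerivAt_mul hpd hH' hu)
      (hX.hasDerivAt_deriv hU hp hH' hu) (hXd u hu)).deriv, hM u hu, mul_assoc, block_mul_block]
  simp only [mul_zero, zero_mul, mul_one, add_zero, zero_add, neg_add_cancel]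

theorem exists_eq_shear_mul_of_isLift (hH : ContDiffOn ℝ ∞ H U)
    (hHs : ∀ u ∈ U, IsSelfAdjoint (H u)) (hHH : ∀ u ∈ U, HH u = P.graph (H u))
    {N : ℝ → T →L[ℝ] T} (hN : S.IsLift U HH P.minus N) :
    ∃ a c d : ℝ → P.plus →L[ℝ] P.plus,
      ContDiffOn ℝ ∞ a U ∧ ContDiffOn ℝ ∞ c U ∧ ContDiffOn ℝ ∞ d U ∧ ∀ u ∈ U,
        N u = P.shear (H u) * P.block (a u) 0 (c u) (d u) ∧ star (d u) * a u = 1 ∧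
          IsUnit (d u) := by
  have hF : ContDiffOn ℝ ∞ (fun t => P.shear (-H t) * N t) U :=
    (P.contDiffOn_block contDiffOn_const hH.neg contDiffOn_const contDiffOn_const).mul hN.smooth
  obtain ⟨a, b, c, d, ha, hc, hd, hblock⟩ := P.exists_contDiffOn_eq_block hF
  refine ⟨a, c, d, ha, hc, hd, fun u hu => ?_⟩
  have hNu : N u = P.shear (H u) * P.block (a u) (b u) (c u) (d u) := by
    rw [← hblock, ← mul_assoc, shear_mul_shear_neg, one_mul]
  have hb : b u = 0 := by
    ext1 k
    have hk : N u (P.J k) ∈ HH u :=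
      (hN.comap_eq u hu).ge (P.mem_minus_iff_fst.2 (P.fst_J k))
    rw [hHH u hu, hNu, mul_apply_eq_comp, shear_apply_mem_graph_iff, mem_minus_iff_fst] at hk
    simpa using hk
  have hcan : S.IsCanonical (P.block (a u) 0 (c u) (d u)) := by
    rw [← hb, ← hblock]
    exact (P.isCanonical_shear (hHs u hu).neg).mul (hN.canonical u hu)
  exact ⟨hb ▸ hNu, P.star_mul_eq_one_and_isUnit_of_isCanonical hcan⟩

theorem exists_isParallelFrame_of_isLift (hU : IsOpen U) (hH : ContDiffOn ℝ ∞ H U)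
    (hHs : ∀ u ∈ U, IsSelfAdjoint (H u)) (hH' : ∀ u ∈ U, IsUnit (deriv H u))
    (hHH : ∀ u ∈ U, HH u = P.graph (H u)) {N : ℝ → T →L[ℝ] T} (hN : S.IsLift U HH P.minus N)
    (hC : ∀ u ∈ U, ∃ C, maurerCartan N u = P.block 0 1 C 0) :
    ∃ X, IsParallelFrame U (deriv H) X ∧ ∀ u ∈ U, N u = P.lift H X u := by
  obtain ⟨a, c, d, ha, hc, hd, hN'⟩ := P.exists_eq_shear_mul_of_isLift hH hHs hHH hN
  have hHd (u) (hu : u ∈ U) := hasDerivAt_deriv_of_contDiffOn hU hH hu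
  have hdd (u) (hu : u ∈ U) := hasDerivAt_deriv_of_contDiffOn hU hd hu
  -- The second column of `N⁻¹ Ṅ` determines `N` from its lower right block.
  have hrel (u) (hu : u ∈ U) :
      deriv a u = -(deriv H u * c u) ∧ deriv H u * d u = a u ∧ deriv d u = c u := by
    obtain ⟨C, hC⟩ := hC u hu
    have hNu : IsUnit (N u) := (S.isCanonical_iff.1 (hN.canonical u hu)).1
    have hNd := P.hasDerivAt_shear_mul_block (hHd u hu)
      (hasDerivAt_deriv_of_contDiffOn hU ha hu) (hasDerivAt_deriv_of_contDiffOn hU hc hu) (hdd u hu)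
    have hNN : N =ᶠ[𝓝 u] fun t => P.shear (H t) * P.block (a t) 0 (c t) (d t) :=
      Filter.eventuallyEq_of_mem (hU.mem_nhds hu) fun t ht => (hN' t ht).1
    rw [maurerCartan_eq_iff hNu, hNN.deriv_eq, hNd.deriv, (hN' u hu).1, mul_assoc,
      (P.isUnit_shear _).mul_right_inj, block_mul_block, block_inj] at hC
    simp only [mul_zero, zero_mul, mul_one, add_zero, zero_add] at hC
    exact ⟨eq_neg_of_add_eq_zero_left hC.1, hC.2.1, hC.2.2.2⟩
  refine ⟨d, .of_hasDerivAt_mul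
    (fun u hu => hasDerivAt_deriv_of_contDiffOn hU (contDiffOn_deriv hU hH) hu) hH' hdd
    (fun u hu => ?_) (fun u hu => (hN' u hu).2.2) fun u hu => ?_, fun u hu => ?_⟩
  · rw [(hrel u hu).2.2, ← (hrel u hu).1]
    exact (hasDerivAt_deriv_of_contDiffOn hU ha hu).congr_of_eventuallyEq
      (Filter.eventuallyEq_of_mem (hU.mem_nhds hu) fun t ht => (hrel t ht).2.1)
  · rw [mul_assoc, (hrel u hu).2.1, (hN' u hu).2.1]
  · rw [P.lift_eq_shear_mul (hHd u hu) (hdd u hu), (hrel u hu).2.1, (hrel u hu).2.2, (hN' u hu).1]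

end Lift

/-! ### Curves of graphs -/

theorem exists_eq_graph {L : Submodule ℝ T} (h : L.IsTopCompl P.plus) :
    ∃ H : P.plus →L[ℝ] P.plus, L = P.graph H := by
  refine ⟨P.fst ∘L L.projectionL P.plus h ∘L P.J ∘L P.plus.subtypeL, ?_⟩
  ext x
  have hfst : L.projectionL P.plus h (P.J (P.snd x)) = L.projectionL P.plus h x := by
    conv_rhs => rw [← P.fst_add_J_snd x, map_add, L.projectionL_apply_right h, zero_add]
  have hsnd : P.snd (L.projectionL P.plus h x) = P.snd x := by
    obtain ⟨k, hk⟩ : ∃ k : P.plus, P.plus.projectionL L h.symm x = k :=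
      ⟨⟨_, P.plus.projectionL_apply_mem h.symm x⟩, rfl⟩
    conv_rhs => rw [← L.projectionL_add_projectionL_eq_self h x, map_add, hk, snd_coe, add_zero]
  have hmem : P.fst x = P.fst (L.projectionL P.plus h x) ↔ x ∈ L := by
    rw [← L.projectionL_eq_self_iff h]
    exact ⟨fun hx => P.ext_fst_snd hx.symm hsnd, fun hx => by rw [hx]⟩
  rw [mem_graph, ← hmem, ← hfst]
  rfl

theorem add_J_mem_graph (H : P.plus →L[ℝ] P.plus) (k : P.plus) :
    (H k : T) + P.J k ∈ P.graph H := ⟨k, rfl⟩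

theorem isSelfAdjoint_of_isIsotropic_graph {H : P.plus →L[ℝ] P.plus}
    (h : S.IsIsotropic (P.graph H)) : IsSelfAdjoint H := by
  refine (P.eq_adj _ _ fun k l => ?_).symm
  have hform := h _ (P.add_J_mem_graph H k) _ (P.add_J_mem_graph H l)
  rw [P.form_eq, fst_split_symm, fst_split_symm, snd_split_symm, snd_split_symm] at hform
  linarith

/-- The lower left block of an operator on `T`, in the sense of `block`. That of a reflection
`[graph A, graph B]` is `2 (A - B)⁻¹`, so that tangent covectors determine derivatives. -/
def lowerLeft : (T →L[ℝ] T) →L[ℝ] P.plus →L[ℝ] P.plus :=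
  ContinuousLinearMap.compL ℝ P.plus T P.plus P.snd ∘L
    (ContinuousLinearMap.compL ℝ P.plus T T).flip P.plus.subtypeL

theorem lowerLeft_apply (F : T →L[ℝ] T) (k : P.plus) : P.lowerLeft F k = P.snd (F k) := rfl

theorem form_apply_eq_g_lowerLeft (F : T →L[ℝ] T) (k : P.plus) :
    S.form (F k) k = P.g (P.lowerLeft F k) k := by
  simp [P.form_eq, lowerLeft_apply]

theorem sub_mul_lowerLeft_reflection_eq_one {A B : P.plus →L[ℝ] P.plus}
    (h : (P.graph A).IsTopCompl (P.graph B)) :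
    (A - B) * P.lowerLeft ((1 / 2 : ℝ) • reflection (P.graph A) (P.graph B)) = 1 := by
  ext1 k
  obtain ⟨x, hx, y, hy, hxy⟩ := Submodule.mem_sup.1
    (h.isCompl.codisjoint.eq_top ▸ Submodule.mem_top : (k : T) ∈ P.graph A ⊔ P.graph B)
  have hsnd : P.snd y = -P.snd x :=
    eq_neg_of_add_eq_zero_right (by rw [← map_add, hxy, snd_coe])
  have hfst : A (P.snd x) - B (P.snd x) = k := by
    rw [sub_eq_add_neg, ← map_neg, ← hsnd, ← P.mem_graph.1 hx, ← P.mem_graph.1 hy, ← map_add, hxy,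
      fst_coe]
  have hcorner : P.lowerLeft ((1 / 2 : ℝ) • reflection (P.graph A) (P.graph B)) k = P.snd x := by
    rw [lowerLeft_apply, smul_apply, ← hxy, reflection_add h hx hy, map_smul, map_sub, hsnd]
    module
  rw [mul_apply_eq_comp, hcorner, sub_apply, hfst, one_apply_eq_self]

theorem lowerLeft_reflection_mul_sub_eq_one {A B : P.plus →L[ℝ] P.plus}
    (h : (P.graph A).IsTopCompl (P.graph B)) :
    P.lowerLeft ((1 / 2 : ℝ) • reflection (P.graph A) (P.graph B)) * (A - B) = 1 := by
  ext1 k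
  have hk : ((A - B) k : T) = (A k + P.J k) + (B (-k) + P.J (-k : P.plus)) := by
    simp only [sub_apply, map_neg, Submodule.coe_sub, Submodule.coe_neg]
    abel
  rw [mul_apply_eq_comp, lowerLeft_apply, hk, smul_apply,
    reflection_add h (P.add_J_mem_graph A k) (P.add_J_mem_graph B (-k)), map_smul, map_sub,
    snd_split_symm, snd_split_symm, one_apply_eq_self]
  module

section Curve

variable {U : Set ℝ} {H : ℝ → P.plus →L[ℝ] P.plus} {HH : ℝ → Submodule ℝ T}

theorem contDiffOn_of_eq_graph (hU : IsOpen U) (hHH : ∀ u ∈ U, HH u = P.graph (H u))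
    (hclosed : ∀ u ∈ U, IsClosed (HH u : Set T))
    (hsmooth : ContDiffOn ℝ ∞ (fun u => reflection (HH u) (HH u)ᗮ) U) : ContDiffOn ℝ ∞ H U := by
  have hproj (u) (hu : u ∈ U) {x y : T} (hx : x ∈ HH u) (hy : y ∈ (HH u)ᗮ) :
      ((1 / 2 : ℝ) • (reflection (HH u) (HH u)ᗮ + 1)) (x + y) = x := by
    have : CompleteSpace (HH u) := (hclosed u hu).completeSpace_coe
    rw [smul_apply, add_apply, reflection_add (HH u).isTopCompl_orthogonal hx hy, one_apply_eq_self]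
    module
  have := P.completeSpace_plus
  refine contDiffOn_of_comp_eq_comp_comp (p := P.fst) (q := P.snd)
    (Q := fun u => (1 / 2 : ℝ) • (reflection (HH u) (HH u)ᗮ + 1)) hU
    ((hsmooth.add contDiffOn_const).const_smul _) (fun u hu => ?_) fun u hu =>
      ⟨(P.plus.subtypeL ∘L H u) + P.J ∘L P.plus.subtypeL, ?_⟩
  · ext1 z
    have : CompleteSpace (HH u) := (hclosed u hu).completeSpace_coe
    obtain ⟨x, hx, y, hy, rfl⟩ := (HH u).exists_add_mem_mem_orthogonal z
    rw [ContinuousLinearMap.comp_apply, ContinuousLinearMap.comp_apply,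
      ContinuousLinearMap.comp_apply, hproj u hu hx hy]
    exact P.mem_graph.1 (hHH u hu ▸ hx)
  · ext1 k
    have hk := hproj u hu (hHH u hu ▸ P.add_J_mem_graph (H u) k) (Submodule.zero_mem _)
    rw [add_zero] at hk
    exact (congrArg P.snd hk).trans (P.snd_split_symm _ _)

theorem deriv_mul_lowerLeft_eq_one (hU : IsOpen U) (hHH : ∀ u ∈ U, HH u = P.graph (H u))
    (hcompl : ∀ s ∈ U, ∀ t ∈ U, s ≠ t → (HH s).IsTopCompl (HH t)) {u : ℝ} (hu : u ∈ U)
    (hH : HasDerivAt H (deriv H u) u) {L : T →L[ℝ] T} (hL : HasTangentCovector HH u L) :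
    deriv H u * P.lowerLeft L = 1 ∧ P.lowerLeft L * deriv H u = 1 := by
  have hlim : Filter.Tendsto
      (fun h : ℝ => h • P.lowerLeft ((1 / 2 : ℝ) • reflection (HH (u + h)) (HH u)))
      (𝓝[≠] 0) (𝓝 (P.lowerLeft L)) := by
    simpa only [Function.comp_def, map_smul] using
      (P.lowerLeft.continuous.tendsto L).comp (tendsto_smul_of_isLittleO hL)
  have hmem : ∀ᶠ h in 𝓝[≠] (0 : ℝ), u + h ∈ U := by
    refine nhdsWithin_le_nhds ((continuous_const.add continuous_id).tendsto' 0 u ?_ ?_)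
    · simp
    · exact hU.mem_nhds hu
  refine mul_eq_one_of_hasDerivAt_of_tendsto (A := P.plus →L[ℝ] P.plus) hH hlim ?_
  filter_upwards [hmem, self_mem_nhdsWithin] with h hhU hh
  have hc := hcompl (u + h) hhU u hu (by simpa using hh)
  rw [hHH _ hhU, hHH u hu] at hc ⊢
  exact ⟨P.sub_mul_lowerLeft_reflection_eq_one hc, P.lowerLeft_reflection_mul_sub_eq_one hc⟩

theorem g_deriv_nonneg_of_lowerLeft {p : P.plus →L[ℝ] P.plus} {L : T →L[ℝ] T}
    (hp : P.lowerLeft L * p = 1) (hL : ∀ x, 0 ≤ S.form (L x) x) (k : P.plus) : 0 ≤ P.g (p k) k := by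
  have hk : P.lowerLeft L (p k) = k := congrArg (fun F : P.plus →L[ℝ] P.plus => F k) hp
  calc 0 ≤ S.form (L (p k)) (p k) := hL _
    _ = P.g (p k) k := by rw [form_apply_eq_g_lowerLeft, hk, P.g_comm]

end Curve

/-- On `U`, the curve of subspaces `HH` is the graph of the smooth curve `H` of self-adjoint
operators, and `H` has an invertible positive definite derivative: the coordinate description of
positive regular curves of Lagrangian subspaces complementary to `K₊`. -/
structure IsMonotoneGraph (U : Set ℝ) (HH : ℝ → Submodule ℝ T) (H : ℝ → P.plus →L[ℝ] P.plus) :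
    Prop where
  eq_graph : ∀ u ∈ U, HH u = P.graph (H u)
  contDiffOn : ContDiffOn ℝ ∞ H U
  adj_eq : ∀ u ∈ U, P.adj (H u) = H u
  isUnit_deriv : ∀ u ∈ U, IsUnit (deriv H u)
  deriv_pos : ∀ u ∈ U, ∀ k : P.plus, k ≠ 0 → 0 < P.g (deriv H u k) k

variable {U : Set ℝ} {HH : ℝ → Submodule ℝ T} {H X : ℝ → P.plus →L[ℝ] P.plus}

theorem exists_isMonotoneGraph (hU : IsOpen U) (hHH : S.IsPositiveRegularCurve U HH)
    (hplus : ∀ u ∈ U, (HH u).IsTopCompl P.plus) : ∃ H, P.IsMonotoneGraph U HH H := by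
  obtain ⟨hreg, hlag, hpos⟩ := hHH
  choose! H hgraph using fun u hu => P.exists_eq_graph (hplus u hu)
  have hH : ContDiffOn ℝ ∞ H U := P.contDiffOn_of_eq_graph hU hgraph hreg.isClosed hreg.smooth
  have hadj (u) (hu : u ∈ U) : IsSelfAdjoint (H u) :=
    P.isSelfAdjoint_of_isIsotropic_graph (hgraph u hu ▸ (hlag u hu).prop)
  have hinv (u) (hu : u ∈ U) {L} (hL : HasTangentCovector HH u L) :=
    P.deriv_mul_lowerLeft_eq_one hU hgraph hreg.nondegenerate hu
      (hasDerivAt_deriv_of_contDiffOn hU hH hu) hL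
  have hunit (u) (hu : u ∈ U) : IsUnit (deriv H u) := by
    obtain ⟨L, hL⟩ := hreg.codifferentiable u hu
    exact ⟨⟨_, _, (hinv u hu hL).1, (hinv u hu hL).2⟩, rfl⟩
  refine ⟨H, hgraph, hH, hadj, hunit, fun u hu k hk => ?_⟩
  obtain ⟨L, hL, hLpos⟩ := hpos u hu
  exact P.g_apply_self_pos (hunit u hu)
    (isSelfAdjoint_deriv (A := P.plus →L[ℝ] P.plus) hU hadj hu)
    (P.g_deriv_nonneg_of_lowerLeft (hinv u hu hL).2 hLpos) hk

namespace IsMonotoneGraph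

variable {P}

theorem hasDerivAt (h : P.IsMonotoneGraph U HH H) (hU : IsOpen U) {u : ℝ} (hu : u ∈ U) :
    HasDerivAt H (deriv H u) u := hasDerivAt_deriv_of_contDiffOn hU h.contDiffOn hu

theorem contDiffOn_deriv (h : P.IsMonotoneGraph U HH H) (hU : IsOpen U) :
    ContDiffOn ℝ ∞ (deriv H) U := LagrangeLift.contDiffOn_deriv hU h.contDiffOn

theorem isSelfAdjoint_deriv (h : P.IsMonotoneGraph U HH H) (hU : IsOpen U) (u : ℝ) (hu : u ∈ U) :
    IsSelfAdjoint (deriv H u) :=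
  LagrangeLift.isSelfAdjoint_deriv (A := P.plus →L[ℝ] P.plus) hU
    (fun t ht => P.isSelfAdjoint_iff.2 (h.adj_eq t ht)) hu

theorem exists_isFrame (h : P.IsMonotoneGraph U HH H) (hU : IsOpen U) (hU' : U.OrdConnected) :
    ∃ X, P.IsFrame U H X := by
  simp only [isFrame_iff_isParallelFrame]
  refine exists_isParallelFrame hU hU' (h.contDiffOn_deriv hU) (h.isSelfAdjoint_deriv hU)
    fun u hu => P.segment_one_subset_isUnit (h.isUnit_deriv u hu) fun k => ?_
  obtain rfl | hk := eq_or_ne k 0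
  · simp
  · exact (h.deriv_pos u hu k hk).le

theorem hasDerivAt_frame (h : P.IsMonotoneGraph U HH H) (hU : IsOpen U) (hX : P.IsFrame U H X)
    {u : ℝ} (hu : u ∈ U) : HasDerivAt X (deriv X u) u :=
  hasDerivAt_deriv_of_contDiffOn hU ((P.isFrame_iff_isParallelFrame.1 hX).contDiffOn hU
    (h.contDiffOn_deriv hU) h.isUnit_deriv) hu

theorem isLift_lift (h : P.IsMonotoneGraph U HH H) (hU : IsOpen U) (hX : P.IsFrame U H X) :
    S.IsLift U HH P.minus (P.lift H X) :=
  P.isLift_lift hU h.contDiffOn h.adj_eq h.isUnit_deriv h.eq_graph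
    (P.isFrame_iff_isParallelFrame.1 hX)

theorem maurerCartan_lift (h : P.IsMonotoneGraph U HH H) (hU : IsOpen U) (hX : P.IsFrame U H X)
    {u : ℝ} (hu : u ∈ U) :
    maurerCartan (P.lift H X) u = P.block 0 1 (-(1 / 2 : ℝ) • P.schwarzian H X u) 0 := by
  rw [schwarzian_eq_frameSchwarzian, P.maurerCartan_lift hU h.contDiffOn h.isUnit_deriv
    (P.isFrame_iff_isParallelFrame.1 hX) hu]

theorem adj_schwarzian (h : P.IsMonotoneGraph U HH H) (hU : IsOpen U)
    (X : ℝ → P.plus →L[ℝ] P.plus) {u : ℝ} (hu : u ∈ U) :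
    P.adj (P.schwarzian H X u) = P.schwarzian H X u := by
  rw [schwarzian_eq_frameSchwarzian]
  exact isSelfAdjoint_frameSchwarzian hU (h.isSelfAdjoint_deriv hU) X hu

theorem exists_eq_mul_right (h : P.IsMonotoneGraph U HH H) (hU : IsOpen U) (hU' : U.OrdConnected)
    {Y : ℝ → P.plus →L[ℝ] P.plus} (hX : P.IsFrame U H X) (hY : P.IsFrame U H Y) :
    ∃ R, P.IsOrthogonal R ∧
      ∀ u ∈ U, Y u = X u * R ∧ P.lift H Y u = P.lift H X u * P.block R 0 0 R := by
  obtain ⟨R, hR, hXY⟩ := (P.isFrame_iff_isParallelFrame.1 hX).exists_eq_mul_right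
    (P.isFrame_iff_isParallelFrame.1 hY) hU hU'
    (fun u hu => hasDerivAt_deriv_of_contDiffOn hU (h.contDiffOn_deriv hU) hu) h.isUnit_deriv
    (h.isSelfAdjoint_deriv hU)
  exact ⟨R, P.isOrthogonal_iff_mem_unitary.2 hR, fun u hu => ⟨hXY u hu,
    P.lift_mul_right hU hXY hu (h.hasDerivAt hU hu) (h.hasDerivAt_frame hU hX hu)⟩⟩

theorem exists_isFrame_of_isLift (h : P.IsMonotoneGraph U HH H) (hU : IsOpen U)
    {N : ℝ → T →L[ℝ] T} (hN : S.IsLift U HH P.minus N)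
    (hC : ∀ u ∈ U, ∃ C, maurerCartan N u = P.block 0 1 C 0) :
    ∃ X, P.IsFrame U H X ∧ ∀ u ∈ U, N u = P.lift H X u := by
  simp only [isFrame_iff_isParallelFrame]
  exact P.exists_isParallelFrame_of_isLift hU h.contDiffOn h.adj_eq h.isUnit_deriv h.eq_graph hN hC

theorem exists_eq_lift_mul (h : P.IsMonotoneGraph U HH H) (hU : IsOpen U) (hU' : U.OrdConnected)
    (hX : P.IsFrame U H X) {N : ℝ → T →L[ℝ] T} (hN : S.IsLift U HH P.minus N)
    (hC : ∀ u ∈ U, ∃ C, maurerCartan N u = P.block 0 1 C 0) :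
    ∃ R, P.IsOrthogonal R ∧ ∀ u ∈ U, N u = P.lift H X u * P.block R 0 0 R := by
  obtain ⟨Y, hY, hNY⟩ := h.exists_isFrame_of_isLift hU hN hC
  obtain ⟨R, hR, hXY⟩ := h.exists_eq_mul_right hU hU' hX hY
  exact ⟨R, hR, fun u hu => (hNY u hu).trans (hXY u hu).2⟩

end IsMonotoneGraph

theorem IsFrame.mul_right {P : HyperbolicStructure S} {H X : ℝ → P.plus →L[ℝ] P.plus}
    (hX : P.IsFrame U H X) {R : P.plus →L[ℝ] P.plus} (hR : P.IsOrthogonal R) :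
    P.IsFrame U H fun u => X u * R :=
  P.isFrame_iff_isParallelFrame.2 <|
    (P.isFrame_iff_isParallelFrame.1 hX).mul_right (P.isOrthogonal_iff_mem_unitary.1 hR)

end HyperbolicStructure

end LagrangeLift

end

theorem mainTheorem3_general {T : Type*} [NormedAddCommGroup T] [InnerProductSpace ℝ T]
    [CompleteSpace T] (S : LagrangeLift.SymplecticStructure T)
    (U : Set ℝ) (hU : IsOpen U) (hU' : U.OrdConnected)
    (HH : ℝ → Submodule ℝ T) (hH : S.IsPositiveRegularCurve U HH)
    (P : LagrangeLift.HyperbolicStructure S)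
    (hplus : ∀ u ∈ U, (HH u).IsTopCompl P.plus) :
    ∃ H : ℝ → P.plus →L[ℝ] P.plus,
      (∀ u ∈ U, HH u = P.graph (H u)) ∧
      ContDiffOn ℝ ∞ H U ∧
      (∀ u ∈ U, P.adj (H u) = H u) ∧
      (∀ u ∈ U, IsUnit (deriv H u) ∧ ∀ k : P.plus, k ≠ 0 → 0 < P.g (deriv H u k) k) ∧
      (∃ X, P.IsFrame U H X) ∧
      ∀ X, P.IsFrame U H X →
        S.IsLift U HH P.minus (P.lift H X) ∧
        (∀ u ∈ U, LagrangeLift.maurerCartan (P.lift H X) u =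
          P.block 0 1 (-(1 / 2 : ℝ) • P.schwarzian H X u) 0) ∧
        (∀ u ∈ U, P.adj (P.schwarzian H X u) = P.schwarzian H X u) ∧
        (∀ R, P.IsOrthogonal R →
          P.IsFrame U H (fun u => X u * R) ∧
          ∀ u ∈ U, P.lift H (fun t => X t * R) u = P.lift H X u * P.block R 0 0 R) ∧
        (∀ X', P.IsFrame U H X' → ∃ R, P.IsOrthogonal R ∧
          ∀ u ∈ U, X' u = X u * R ∧ P.lift H X' u = P.lift H X u * P.block R 0 0 R) ∧
        (∀ N : ℝ → T →L[ℝ] T, S.IsLift U HH P.minus N →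
          (∀ u ∈ U, ∃ C, LagrangeLift.maurerCartan N u = P.block 0 1 C 0) →
          ∃ R, P.IsOrthogonal R ∧ ∀ u ∈ U, N u = P.lift H X u * P.block R 0 0 R) := by
  obtain ⟨H, h⟩ := P.exists_isMonotoneGraph hU hH hplus
  refine ⟨H, h.eq_graph, h.contDiffOn, h.adj_eq,
    fun u hu => ⟨h.isUnit_deriv u hu, h.deriv_pos u hu⟩, h.exists_isFrame hU hU', fun X hX =>
      ⟨h.isLift_lift hU hX, fun u hu => h.maurerCartan_lift hU hX hu,
        fun u hu => h.adj_schwarzian hU X hu, fun R hR => ⟨hX.mul_right hR, fun u hu => ?_⟩,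
        fun X' hX' => h.exists_eq_mul_right hU hU' hX hX',
        fun N hN hC => h.exists_eq_lift_mul hU hU' hX hN hC⟩⟩
  exact P.lift_mul_right hU (fun _ _ => rfl) hu (h.hasDerivAt hU hu) (h.hasDerivAt_frame hU hX hu)

theorem mainTheorem3 {T : Type*} [NormedAddCommGroup T] [InnerProductSpace ℝ T] [CompleteSpace T]
    (S : LagrangeLift.SymplecticStructure T)
    (U : Set ℝ) (hU : IsOpen U) (hU' : U.OrdConnected)
    (HH : ℝ → Submodule ℝ T) (hH : S.IsPositiveRegularCurve U HH)
    (P : LagrangeLift.HyperbolicStructure S)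
    (hplus : ∀ u ∈ U, (HH u).IsTopCompl P.plus)
    (hminus : ∀ u ∈ U, (HH u).IsTopCompl P.minus) :
    ∃ H : ℝ → P.plus →L[ℝ] P.plus,
      -- the curve is the graph of a smooth curve of symmetric operators with positive derivative
      (∀ u ∈ U, HH u = P.graph (H u)) ∧
      ContDiffOn ℝ ∞ H U ∧
      (∀ u ∈ U, P.adj (H u) = H u) ∧
      (∀ u ∈ U, IsUnit (deriv H u) ∧ ∀ k : P.plus, k ≠ 0 → 0 < P.g (deriv H u k) k) ∧
      -- the equations for `X` are solvable on all of `U`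
      (∃ X, P.IsFrame U H X) ∧
      ∀ X, P.IsFrame U H X →
        -- `M` is a lift to the symplectic group
        S.IsLift U HH P.minus (P.lift H X) ∧
        -- its Maurer–Cartan form, with symmetric `S`
        (∀ u ∈ U, LagrangeLift.maurerCartan (P.lift H X) u =
          P.block 0 1 (-(1 / 2 : ℝ) • P.schwarzian H X u) 0) ∧
        (∀ u ∈ U, P.adj (P.schwarzian H X u) = P.schwarzian H X u) ∧
        -- the freedom is exactly a constant right factor in `O(K₊)`
        (∀ R, P.IsOrthogonal R →
          P.IsFrame U H (fun u => X u * R) ∧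
          ∀ u ∈ U, P.lift H (fun t => X t * R) u = P.lift H X u * P.block R 0 0 R) ∧
        (∀ X', P.IsFrame U H X' → ∃ R, P.IsOrthogonal R ∧
          ∀ u ∈ U, X' u = X u * R ∧ P.lift H X' u = P.lift H X u * P.block R 0 0 R) ∧
        -- the lift is canonical: it is the only one whose Maurer–Cartan form has this shape
        (∀ N : ℝ → T →L[ℝ] T, S.IsLift U HH P.minus N →
          (∀ u ∈ U, ∃ C, LagrangeLift.maurerCartan N u = P.block 0 1 C 0) →
          ∃ R, P.IsOrthogonal R ∧ ∀ u ∈ U, N u = P.lift H X u * P.block R 0 0 R) :=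
  mainTheorem3_general S U hU hU' HH hH P hplus
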